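/- Let $a,b>0$ and let $\xi\in(0,1)$ be irrational. For $\alpha\ge 0$ let $\mathcal A_\alpha$ be the unbounded operator on $\mathcal H=[H^2(0,1)\cap H^1_0(0,1)]\times L^2(0,1)$ given by $$\mathcal A_\alpha(u,v)=\big(v,\,-a\,u''''-b\,v-\alpha v(\xi)\delta_\xi\big),$$ whose domain is the set of $(u,v)$ with $u\in H^4(0,\xi)\cap H^4(\xi,1)\cap H^2(0,1)$, $v\in H^2(0,1)$, $u(0)=u(1)=v(0)=v(1)=u''(0)=u''(1)=0$, $u''(\xi^-)=u''(\xi^+)$ and $u'''(\xi^+)-u'''(\xi^-)=-\frac{\alpha}{a}v(\xi)$. (The Dirac mass in the formula cancels the one in the distributional derivative $u''''$ on $(0,1)$.) For $n\ge 1$ put $$\mu_n^\pm=\tfrac12\big(-b\pm\sqrt{b^2-4an^4\pi^4}\big)\ \text{ if } 4an^4\pi^4\le b^2,\qquad \mu_n^\pm=\tfrac12\big(-b\pm i\sqrt{4an^4\pi^4-b^2}\big)\ \text{ otherwise},$$ and $\Phi_n^\pm(x)=\sin(n\pi x)\,(1,\mu_n^\pm)$. For $\mu\in\mathbb C$ and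 a nonzero fourth root $\lambda$ of $-(b\mu+\mu^2)/a$ put $\Phi(\mu,x)=\phi(\lambda,x)(1,\mu)$, where $$\phi(\lambda,x)=\frac{e^{(\xi-2)|\lambda|}}{|\lambda|^2}\Big\{\sin\lambda\,\sinh\lambda\,\big[\sinh(\lambda(x-\xi))-\sin(\lambda(x-\xi))\big]H(x,\xi)+\sinh\lambda\,\sin(\lambda(1-\xi))\sin(\lambda x)-\sin\lambda\,\sinh(\lambda(1-\xi))\sinh(\lambda x)\Big\}$$ and $H(x,\xi)=1$ if $x\ge\xi$, $H(x,\xi)=0$ if $x<\xi$. 1. (Continuity of the eigenvalues.) There are continuous functions $m_j:[0,6/b)\to\mathbb C$, $j\in\mathbb N$, such that for every $\alpha\in[0,6/b)$ the set of eigenvalues of $\mathcal A_\alpha$ is exactly $\{m_j(\alpha): j\in\mathbb N\}$ (repetitions being allowed), and such that for every $R$ only finitely many indices $j$ satisfy $|m_j(\alpha)|\le R$ for some $\alpha\in[0,6/b)$. In particular every eigenvalue of every $\mathcal A_\alpha$, $\alpha>0$, $\alpha b<6$, can be followed continuously in $\alpha$ over the whole interval. 2. (Convergence of the eigenvectors.)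 Let $0<\alpha_1\le 6/b$, let $\mu:(0,\alpha_1)\to\mathbb C$ be continuous with $\mu(\alpha)$ an eigenvalue of $\mathcal A_\alpha$ for every $\alpha$, and let $\lambda(\alpha)$ be the fourth root of $-(b\mu(\alpha)+\mu(\alpha)^2)/a$ with argument in $[-\pi/4,\pi/4)$. Then there are $n\ge 1$ and a sign $\pm$ such that $\Phi_n^\pm$ is an eigenvector of $\mathcal A_0$ for the eigenvalue $\mu_n^\pm$ and $\mu(\alpha)\to\mu_n^\pm$ as $\alpha\to0^+$. Moreover, for each $\zeta\in\{1,-1,i,-i\}$, with $\Phi(\mu(\alpha),\cdot)$ formed with the fourth root $\zeta\lambda(\alpha)$: for all sufficiently small $\alpha>0$ the function $\Phi(\mu(\alpha),\cdot)$ is an eigenvector of $\mathcal A_\alpha$ for the eigenvalue $\mu(\alpha)$, and there is a constant $c\ne0$ such that $\Phi(\mu(\alpha),x)\to c\,\Phi_n^\pm(x)$ as $\alpha\to0^+$ for every $x\in(0,1)$. -/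

import Mathlib

open Set Filter Topology MeasureTheory

noncomputable section

namespace Beam

/-- The complex Hilbert space `L²(0,1)`. -/
abbrev L2 : Type := Lp ℂ 2 (volume.restrict (Ioo (0 : ℝ) 1))

/-- `p 0` is (the continuous representative of) a function in the Sobolev space `H^k(c,d)`, and
`p 1, …, p k` are its successive weak derivatives: for `i < k` the function `p i` is absolutely
continuous on `[c,d]` with derivative `p (i+1)`, and the last derivative `p k` is square
integrable. So for `i < k` the value `p i x` is the trace of the `i`-th derivative, at
the end points `c`, `d` as well. -/
def IsSobolev (k : ℕ) (c d : ℝ) (p : ℕ → ℝ → ℂ) : Prop :=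
  (∀ i < k, IntervalIntegrable (p (i + 1)) volume c d ∧
    ∀ x ∈ Icc c d, p i x = p i c + ∫ t in c..x, p (i + 1) t) ∧
  MemLp (p k) 2 (volume.restrict (Ioo c d))

theorem IsSobolev.zero (k : ℕ) (c d : ℝ) : IsSobolev k c d 0 := by
  refine ⟨fun i _ => ⟨?_, fun x _ => ?_⟩, ?_⟩
  · exact IntervalIntegrable.zero
  · simp
  · exact MemLp.zero

theorem IsSobolev.add {k : ℕ} {c d : ℝ} {p q : ℕ → ℝ → ℂ}
    (hp : IsSobolev k c d p) (hq : IsSobolev k c d q) : IsSobolev k c d (p + q) := by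
  refine ⟨fun i hi => ⟨?_, fun x hx => ?_⟩, hp.2.add hq.2⟩
  · exact (hp.1 i hi).1.add (hq.1 i hi).1
  · have hsub : uIcc c x ⊆ uIcc c d := by
      rw [uIcc_of_le hx.1, uIcc_of_le (hx.1.trans hx.2)]
      exact Icc_subset_Icc_right hx.2
    have h := intervalIntegral.integral_add ((hp.1 i hi).1.mono_set hsub)
      ((hq.1 i hi).1.mono_set hsub)
    simp only [Pi.add_apply]
    rw [h, (hp.1 i hi).2 x hx, (hq.1 i hi).2 x hx]
    ring

theorem IsSobolev.smul {k : ℕ} {c d : ℝ} {p : ℕ → ℝ → ℂ} (z : ℂ)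
    (hp : IsSobolev k c d p) : IsSobolev k c d (z • p) := by
  refine ⟨fun i hi => ⟨?_, fun x hx => ?_⟩, hp.2.const_smul z⟩
  · exact (hp.1 i hi).1.smul z
  · simp only [Pi.smul_apply]
    rw [intervalIntegral.integral_smul, (hp.1 i hi).2 x hx, smul_add]

/-- The space `H²(0,1) ∩ H¹₀(0,1)`, as a subspace of `L²(0,1)`. -/
def V : Submodule ℂ L2 where
  carrier := {f | ∃ p : ℕ → ℝ → ℂ, IsSobolev 2 0 1 p ∧ p 0 0 = 0 ∧ p 0 1 = 0 ∧
    (f : ℝ → ℂ) =ᵐ[volume.restrict (Ioo 0 1)] p 0}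
  zero_mem' := ⟨0, IsSobolev.zero _ _ _, rfl, rfl, Lp.coeFn_zero _ _ _⟩
  add_mem' := by
    rintro f g ⟨p, hp, hp0, hp1, hfp⟩ ⟨q, hq, hq0, hq1, hgq⟩
    refine ⟨p + q, hp.add hq, by simp [hp0, hq0], by simp [hp1, hq1], ?_⟩
    filter_upwards [Lp.coeFn_add f g, hfp, hgq] with x h1 h2 h3
    rw [h1, Pi.add_apply, h2, h3]; rfl
  smul_mem' := by
    rintro z f ⟨p, hp, hp0, hp1, hfp⟩
    refine ⟨z • p, hp.smul z, by simp [hp0], by simp [hp1], ?_⟩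
    filter_upwards [Lp.coeFn_smul z f, hfp] with x h1 h2
    rw [h1, Pi.smul_apply, h2]; rfl

/-- The energy space `[H²(0,1) ∩ H¹₀(0,1)] × L²(0,1)` (as a complex vector space). -/
abbrev Energy : Type := V × L2

/-- `InGraph a b α ξ U F` says that `U = (u,v)` belongs to the domain of the beam operator and that
its image is `F`. Here `l`, `r` are `u` with its derivatives on `(0,ξ)` and on `(ξ,1)`, and `q` is
`v` with its derivatives on `(0,1)`. The conditions are
`u ∈ H⁴(0,ξ) ∩ H⁴(ξ,1) ∩ H²(0,1)`, `v ∈ H²(0,1)`, `u(0) = u(1) = v(0) = v(1) = 0`,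
`u''(0) = u''(1) = 0`, `u''(ξ⁻) = u''(ξ⁺)`, `u'''(ξ⁺) - u'''(ξ⁻) = -(α/a) v(ξ)`, and
`F = (v, -a u'''' - b v - α v(ξ) δ_ξ)`; the fourth derivative in the sense of distributions on
`(0,1)` has at `ξ` the mass `u'''(ξ⁺) - u'''(ξ⁻)`, which cancels the Dirac mass, so that the second
component is `-a u'''' - b v` with the fourth derivative taken on `(0,ξ)` and on `(ξ,1)`. -/
def InGraph (a b α ξ : ℝ) (U F : Energy) : Prop :=
  (F.1 : L2) = U.2 ∧
  ∃ l r q : ℕ → ℝ → ℂ,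
    IsSobolev 4 0 ξ l ∧ IsSobolev 4 ξ 1 r ∧ IsSobolev 2 0 1 q ∧
    ((U.1 : L2) : ℝ → ℂ) =ᵐ[volume.restrict (Ioo 0 ξ)] l 0 ∧
    ((U.1 : L2) : ℝ → ℂ) =ᵐ[volume.restrict (Ioo ξ 1)] r 0 ∧
    (U.2 : ℝ → ℂ) =ᵐ[volume.restrict (Ioo 0 1)] q 0 ∧
    l 2 0 = 0 ∧ r 2 1 = 0 ∧ l 2 ξ = r 2 ξ ∧
    r 3 ξ - l 3 ξ = -((α / a : ℝ) : ℂ) * q 0 ξ ∧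
    (F.2 : ℝ → ℂ) =ᵐ[volume.restrict (Ioo 0 ξ)] (fun x => -(a : ℂ) * l 4 x - (b : ℂ) * U.2 x) ∧
    (F.2 : ℝ → ℂ) =ᵐ[volume.restrict (Ioo ξ 1)] (fun x => -(a : ℂ) * r 4 x - (b : ℂ) * U.2 x)

theorem ae_restrict_of_Ioo {P : ℝ → Prop} {c d : ℝ} (h0 : 0 ≤ c) (h1 : d ≤ 1)
    (h : ∀ᵐ x ∂(volume.restrict (Ioo (0 : ℝ) 1)), P x) :
    ∀ᵐ x ∂(volume.restrict (Ioo c d)), P x :=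
  ae_restrict_of_ae_restrict_of_subset (Ioo_subset_Ioo h0 h1) h

/-- The graph of the beam operator is a linear subspace. -/
def graph (a b α : ℝ) (ξ : Ioo (0 : ℝ) 1) : Submodule ℂ (Energy × Energy) where
  carrier := {W | InGraph a b α ξ W.1 W.2}
  zero_mem' := by
    have h0 : ((0 : L2) : ℝ → ℂ) =ᵐ[volume.restrict (Ioo (0 : ℝ) 1)] 0 := Lp.coeFn_zero _ _ _
    have hl := ae_restrict_of_Ioo (c := 0) (d := ξ) le_rfl ξ.2.2.le h0
    have hr := ae_restrict_of_Ioo (c := ξ) (d := 1) ξ.2.1.le le_rfl h0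
    refine ⟨rfl, 0, 0, 0, IsSobolev.zero _ _ _, IsSobolev.zero _ _ _, IsSobolev.zero _ _ _,
      hl, hr, h0, rfl, rfl, rfl, by simp, ?_, ?_⟩
    · filter_upwards [hl] with x hx
      refine hx.trans ?_
      have h5 : ((0 : Energy × Energy).1.2 : ℝ → ℂ) x = 0 := hx
      simp only [h5, Pi.zero_apply, mul_zero, sub_zero]
    · filter_upwards [hr] with x hx
      refine hx.trans ?_
      have h5 : ((0 : Energy × Energy).1.2 : ℝ → ℂ) x = 0 := hx
      simp only [h5, Pi.zero_apply, mul_zero, sub_zero]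
  add_mem' := by
    rintro ⟨U, F⟩ ⟨U', F'⟩ ⟨hv, l, r, q, hl, hr, hq, ul, ur, vq, l0, r1, e2, e3, gl, gr⟩
      ⟨hv', l', r', q', hl', hr', hq', ul', ur', vq', l0', r1', e2', e3', gl', gr'⟩
    have hU1 := Lp.coeFn_add (U.1 : L2) (U'.1 : L2)
    have hU2 := Lp.coeFn_add U.2 U'.2
    have hF2 := Lp.coeFn_add F.2 F'.2
    refine ⟨?_, l + l', r + r', q + q', hl.add hl', hr.add hr', hq.add hq', ?_, ?_, ?_,
      by simp [l0, l0'], by simp [r1, r1'], by simp [e2, e2'], ?_, ?_, ?_⟩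
    · simp only at hv hv'
      simp [hv, hv']
    · filter_upwards [ae_restrict_of_Ioo (c := 0) (d := ξ) le_rfl ξ.2.2.le hU1, ul, ul']
        with x h1 h2 h3
      exact h1.trans (congrArg₂ (· + ·) h2 h3)
    · filter_upwards [ae_restrict_of_Ioo (c := ξ) (d := 1) ξ.2.1.le le_rfl hU1, ur, ur']
        with x h1 h2 h3
      exact h1.trans (congrArg₂ (· + ·) h2 h3)
    · filter_upwards [hU2, vq, vq'] with x h1 h2 h3
      exact h1.trans (congrArg₂ (· + ·) h2 h3)
    · simp only [Pi.add_apply]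
      linear_combination e3 + e3'
    · filter_upwards [ae_restrict_of_Ioo (c := 0) (d := ξ) le_rfl ξ.2.2.le hU2,
        ae_restrict_of_Ioo (c := 0) (d := ξ) le_rfl ξ.2.2.le hF2, gl, gl'] with x h1 h2 h3 h4
      refine h2.trans ?_
      have h5 : (((U, F) + (U', F')).1.2 : ℝ → ℂ) x = U.2 x + U'.2 x := h1
      simp only [Pi.add_apply] at h3 h4 ⊢
      rw [h5, h3, h4]; ring
    · filter_upwards [ae_restrict_of_Ioo (c := ξ) (d := 1) ξ.2.1.le le_rfl hU2,
        ae_restrict_of_Ioo (c := ξ) (d := 1) ξ.2.1.le le_rfl hF2, gr, gr'] with x h1 h2 h3 h4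
      refine h2.trans ?_
      have h5 : (((U, F) + (U', F')).1.2 : ℝ → ℂ) x = U.2 x + U'.2 x := h1
      simp only [Pi.add_apply] at h3 h4 ⊢
      rw [h5, h3, h4]; ring
  smul_mem' := by
    rintro z ⟨U, F⟩ ⟨hv, l, r, q, hl, hr, hq, ul, ur, vq, l0, r1, e2, e3, gl, gr⟩
    have hU1 := Lp.coeFn_smul z (U.1 : L2)
    have hU2 := Lp.coeFn_smul z U.2
    have hF2 := Lp.coeFn_smul z F.2
    refine ⟨?_, z • l, z • r, z • q, hl.smul z, hr.smul z, hq.smul z, ?_, ?_, ?_,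
      by simp [l0], by simp [r1], by simp [e2], ?_, ?_, ?_⟩
    · simp only at hv
      simp [hv]
    · filter_upwards [ae_restrict_of_Ioo (c := 0) (d := ξ) le_rfl ξ.2.2.le hU1, ul] with x h1 h2
      exact h1.trans (congrArg (z • ·) h2)
    · filter_upwards [ae_restrict_of_Ioo (c := ξ) (d := 1) ξ.2.1.le le_rfl hU1, ur] with x h1 h2
      exact h1.trans (congrArg (z • ·) h2)
    · filter_upwards [hU2, vq] with x h1 h2
      exact h1.trans (congrArg (z • ·) h2)
    · simp only [Pi.smul_apply, smul_eq_mul]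
      linear_combination z * e3
    · filter_upwards [ae_restrict_of_Ioo (c := 0) (d := ξ) le_rfl ξ.2.2.le hU2,
        ae_restrict_of_Ioo (c := 0) (d := ξ) le_rfl ξ.2.2.le hF2, gl] with x h1 h2 h3
      refine h2.trans ?_
      have h5 : ((z • (U, F)).1.2 : ℝ → ℂ) x = z * U.2 x := h1
      simp only [Pi.smul_apply, smul_eq_mul] at h3 ⊢
      rw [h5, h3]; ring
    · filter_upwards [ae_restrict_of_Ioo (c := ξ) (d := 1) ξ.2.1.le le_rfl hU2,
        ae_restrict_of_Ioo (c := ξ) (d := 1) ξ.2.1.le le_rfl hF2, gr] with x h1 h2 h3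
      refine h2.trans ?_
      have h5 : ((z • (U, F)).1.2 : ℝ → ℂ) x = z * U.2 x := h1
      simp only [Pi.smul_apply, smul_eq_mul] at h3 ⊢
      rw [h5, h3]; ring

theorem IsSobolev.ae_zero_succ {k : ℕ} {c d : ℝ} {p : ℕ → ℝ → ℂ}
    (hp : IsSobolev k c d p) {i : ℕ} (hi : i < k)
    (h : p i =ᵐ[volume.restrict (Ioo c d)] 0) : p (i + 1) =ᵐ[volume.restrict (Ioo c d)] 0 := by
  rcases le_or_gt d c with hdc | hcd
  · rw [Ioo_eq_empty hdc.not_gt, Measure.restrict_empty, Filter.EventuallyEq, ae_zero]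
    exact Filter.eventually_bot
  obtain ⟨hint, heq⟩ := hp.1 i hi
  have hcont : ContinuousOn (p i) (Ioo c d) := by
    have h1 : ContinuousOn (fun x => ∫ t in c..x, p (i + 1) t) (uIcc c d) :=
      intervalIntegral.continuousOn_primitive_interval' hint left_mem_uIcc
    rw [uIcc_of_le hcd.le] at h1
    refine ((continuousOn_const (c := p i c)).add (h1.mono Ioo_subset_Icc_self)).congr ?_
    intro x hx
    exact heq x (Ioo_subset_Icc_self hx)
  have hzero : EqOn (p i) 0 (Ioo c d) :=
    Measure.eqOn_Ioo_of_ae_eq volume h hcont continuousOn_const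
  rw [Filter.EventuallyEq, ae_restrict_iff' measurableSet_Ioo]
  filter_upwards [hint.ae_hasDerivAt_integral] with x hx hxI
  have hxc : x ∈ uIcc c d := by
    rw [uIcc_of_le hcd.le]; exact Ioo_subset_Icc_self hxI
  have hd := hx hxc c left_mem_uIcc
  have hd' : HasDerivAt (fun _ : ℝ => -p i c) (0 : ℂ) x := hasDerivAt_const _ _
  refine hd.unique (hd'.congr_of_eventuallyEq ?_)
  filter_upwards [Ioo_mem_nhds hxI.1 hxI.2] with y hy
  have h1 := heq y (Ioo_subset_Icc_self hy)
  rw [hzero hy] at h1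
  simp only [Pi.zero_apply] at h1
  linear_combination -h1

theorem graph_singleValued (a b α : ℝ) (ξ : Ioo (0 : ℝ) 1) :
    ∀ W ∈ graph a b α ξ, W.1 = 0 → W.2 = 0 := by
  rintro ⟨U, F⟩ ⟨hv, l, r, q, hl, hr, hq, ul, ur, vq, l0, r1, e2, e3, gl, gr⟩ h
  obtain rfl : U = 0 := h
  have h0 : ((0 : L2) : ℝ → ℂ) =ᵐ[volume.restrict (Ioo (0 : ℝ) 1)] 0 := Lp.coeFn_zero _ _ _
  have h0l := ae_restrict_of_Ioo (c := 0) (d := ξ) le_rfl ξ.2.2.le h0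
  have h0r := ae_restrict_of_Ioo (c := ξ) (d := 1) ξ.2.1.le le_rfl h0
  have hl0 : l 0 =ᵐ[volume.restrict (Ioo (0 : ℝ) ξ)] 0 := ul.symm.trans h0l
  have hr0 : r 0 =ᵐ[volume.restrict (Ioo (ξ : ℝ) 1)] 0 := ur.symm.trans h0r
  have hl4 := hl.ae_zero_succ (i := 3) (by norm_num) (hl.ae_zero_succ (i := 2) (by norm_num)
    (hl.ae_zero_succ (i := 1) (by norm_num) (hl.ae_zero_succ (i := 0) (by norm_num) hl0)))
  have hr4 := hr.ae_zero_succ (i := 3) (by norm_num) (hr.ae_zero_succ (i := 2) (by norm_num)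
    (hr.ae_zero_succ (i := 1) (by norm_num) (hr.ae_zero_succ (i := 0) (by norm_num) hr0)))
  have hFl : ∀ᵐ x ∂(volume.restrict (Ioo (0 : ℝ) ξ)), (F.2 : ℝ → ℂ) x = 0 := by
    filter_upwards [gl, hl4, h0l] with x h1 h2 h3
    have h5 : ((0 : Energy).2 : ℝ → ℂ) x = 0 := h3
    have h6 : l 4 x = 0 := h2
    simp only [h5, h6] at h1
    simpa using h1
  have hFr : ∀ᵐ x ∂(volume.restrict (Ioo (ξ : ℝ) 1)), (F.2 : ℝ → ℂ) x = 0 := by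
    filter_upwards [gr, hr4, h0r] with x h1 h2 h3
    have h5 : ((0 : Energy).2 : ℝ → ℂ) x = 0 := h3
    have h6 : r 4 x = 0 := h2
    simp only [h5, h6] at h1
    simpa using h1
  have hF2 : F.2 = 0 := by
    refine Lp.ext (Filter.EventuallyEq.trans ?_ h0.symm)
    rw [ae_restrict_iff' measurableSet_Ioo] at hFl hFr
    rw [Filter.EventuallyEq, ae_restrict_iff' measurableSet_Ioo]
    filter_upwards [hFl, hFr, (by simp [ae_iff] : ∀ᵐ x : ℝ, x ≠ ξ)] with x h1 h2 h3 hx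
    rcases lt_or_gt_of_ne h3 with h | h
    · exact h1 ⟨hx.1, h⟩
    · exact h2 ⟨h, hx.2⟩
  exact Prod.ext (Subtype.ext hv) hF2

/-- The beam operator `A(u,v) = (v, -a u'''' - b v - α v(ξ) δ_ξ)`, an unbounded linear operator of
the energy space. -/
def A (a b α : ℝ) (ξ : Ioo (0 : ℝ) 1) : Energy →ₗ.[ℂ] Energy :=
  (graph a b α ξ).toLinearPMap

/-- The domain and the values of `A` are those described by `InGraph`. -/
theorem mem_graph_A_iff (a b α : ℝ) (ξ : Ioo (0 : ℝ) 1) (U F : Energy) :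
    (U, F) ∈ (A a b α ξ).graph ↔ InGraph a b α ξ U F := by
  rw [A, Submodule.toLinearPMap_graph_eq _ (graph_singleValued a b α ξ)]
  rfl

/-- `U` is an eigenvector of the unbounded operator `T` for the eigenvalue `μ`. -/
def IsEigenvector (T : Energy →ₗ.[ℂ] Energy) (μ : ℂ) (U : T.domain) : Prop :=
  U ≠ 0 ∧ T U = μ • (U : Energy)

/-- `μ` is an eigenvalue of the unbounded operator `T`. -/
def IsEigenvalue (T : Energy →ₗ.[ℂ] Energy) (μ : ℂ) : Prop :=
  ∃ U : T.domain, IsEigenvector T μ U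

/-- The pair of functions `f = (f₁,f₂)` on `(0,1)` is (a representative of) an eigenvector of `T`
for the eigenvalue `μ`. -/
def IsEigenfunction (T : Energy →ₗ.[ℂ] Energy) (μ : ℂ) (f : ℝ → ℂ × ℂ) : Prop :=
  ∃ U : T.domain, IsEigenvector T μ U ∧
    (((U : Energy).1 : L2) : ℝ → ℂ) =ᵐ[volume.restrict (Ioo 0 1)] (fun x => (f x).1) ∧
    ((U : Energy).2 : ℝ → ℂ) =ᵐ[volume.restrict (Ioo 0 1)] (fun x => (f x).2)

/-- `lam` is the fourth root of `-(bμ + μ²)/a` with argument in `[-π/4, π/4)`. The other fourth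
roots are `-lam` and `± i lam`. -/
def IsPrincipalRoot (a b : ℝ) (μ lam : ℂ) : Prop :=
  lam ^ 4 = -((b : ℂ) * μ + μ ^ 2) / (a : ℂ) ∧ lam.arg ∈ Ico (-(Real.pi / 4)) (Real.pi / 4)

/-- The scalar profile `φ(λ, ·)` of the eigenvectors. -/
def phi (ξ : ℝ) (lam : ℂ) (x : ℝ) : ℂ :=
  ((1 / ‖lam‖ ^ 2 * Real.exp ((ξ - 2) * ‖lam‖) : ℝ) : ℂ) *
    (Complex.sin lam * Complex.sinh lam *
        (Complex.sinh (lam * (x - ξ)) - Complex.sin (lam * (x - ξ))) * (if ξ ≤ x then 1 else 0) +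
      Complex.sinh lam * Complex.sin (lam * (1 - ξ)) * Complex.sin (lam * x) -
      Complex.sin lam * Complex.sinh (lam * (1 - ξ)) * Complex.sinh (lam * x))

/-- The eigenvector `Φ(μ, ·) = φ(λ, ·) (1, μ)`, where `λ` is a fourth root of `-(bμ + μ²)/a`. -/
def Phi (ξ : ℝ) (lam μ : ℂ) (x : ℝ) : ℂ × ℂ :=
  (phi ξ lam x, μ * phi ξ lam x)

/-- The eigenvalues `μ_n^±` for `α = 0`; `s = 1` and `s = -1` stand for the two signs. -/
def muZero (a b : ℝ) (n : ℕ) (s : ℤˣ) : ℂ :=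
  if 4 * a * n ^ 4 * Real.pi ^ 4 ≤ b ^ 2 then
    (1 / 2) * (-(b : ℂ) + ((s : ℤ) : ℂ) * (Real.sqrt (b ^ 2 - 4 * a * n ^ 4 * Real.pi ^ 4) : ℂ))
  else
    (1 / 2) * (-(b : ℂ) + ((s : ℤ) : ℂ) *
      (Complex.I * (Real.sqrt (4 * a * n ^ 4 * Real.pi ^ 4 - b ^ 2) : ℂ)))

/-- The eigenvectors `Φ_n^± = sin(nπx) (1, μ_n^±)` for `α = 0`. -/
def PhiZero (a b : ℝ) (n : ℕ) (s : ℤˣ) (x : ℝ) : ℂ × ℂ :=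
  (Complex.sin (n * Real.pi * x), muZero a b n s * Complex.sin (n * Real.pi * x))

end Beam

end

/-!
Write `w = -(bμ + μ²)/a`. Eliminating `v = μ u`, an eigenvector is a hinged solution of
`u'''' = w u` on both sides of `ξ` whose third derivative jumps by a multiple of `α μ u(ξ)`.
Expressing it through the fundamental solutions of `u'''' = w u` that are entire in `w`, one finds
that `μ` is an eigenvalue if and only if `f(μ) + α g(μ) = 0` for two entire functions `f`, `g`. The
zeros of `f` are those of `sin λ · sinh λ / λ²` with `λ⁴ = w`, that is, the numbers `μ_n^±`, and
there `g` is a nonzero multiple of `μ sin² (nπξ)`, which does not vanish since `ξ` is irrational.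

On large circles `|λ| = (N + 1/2) π` the term `f` dominates, so for bounded `α` no eigenvalue
crosses them, and the eigenvalues between two consecutive circles can be treated as a finite group.
Near each of its zeros, `f + α g = 0` says that `α = -f/g`, hence the zeros are locally the roots of
`α - α₀ = z ^ m` in a suitable coordinate and can be followed continuously in the real parameter
`α`; compactness glues the local branches.

A continuous path of eigenvalues stays bounded as `α → 0⁺` and can only accumulate at the isolated
zeros of `f`, so it converges to some `μ_n^±`. The function `φ` is a multiple of the eigenfunction
obtained by gluing, and it depends continuously on `λ`, which tends to `nπ`.
-/

noncomputable section

namespace Beam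

open scoped Nat

/-- The terms of the power series of `krylov k w`. -/
def krylovTerm (k : ℕ) (w x : ℂ) (j : ℕ) : ℂ := w ^ j * x ^ (4 * j + k) / ((4 * j + k)! : ℂ)

/-- The Krylov functions, that is, the fundamental solutions of `u'''' = w u`. For `k < 4` the
`i`-th derivative of `krylov k w` at `0` is `1` if `i = k` and `0` for the other `i < 4`. They are
entire in `w`, unlike the solutions `sin (l x)` and `sinh (l x)` with `w = l ^ 4`. -/
def krylov (k : ℕ) (w x : ℂ) : ℂ := ∑' j, krylovTerm k w x j

theorem norm_krylovTerm_le {k : ℕ} {w x : ℂ} {W X : ℝ} (hw : ‖w‖ ≤ W) (hx : ‖x‖ ≤ X) (j : ℕ) :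
    ‖krylovTerm k w x j‖ ≤ X ^ k * ((W * X ^ 4) ^ j / j !) := by
  have hW : 0 ≤ W := (norm_nonneg _).trans hw
  have hX : 0 ≤ X := (norm_nonneg _).trans hx
  have hfactorial : (j ! : ℝ) ≤ ((4 * j + k)! : ℝ) := by
    exact_mod_cast Nat.factorial_le (by omega)
  rw [krylovTerm, norm_div, norm_mul, norm_pow, norm_pow, Complex.norm_natCast]
  calc ‖w‖ ^ j * ‖x‖ ^ (4 * j + k) / ((4 * j + k)! : ℝ)
      ≤ W ^ j * X ^ (4 * j + k) / (j ! : ℝ) := by gcongr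
    _ = X ^ k * ((W * X ^ 4) ^ j / j !) := by rw [mul_pow, ← pow_mul, pow_add]; ring

theorem summable_krylovTerm_bound (k : ℕ) (W X : ℝ) :
    Summable fun j : ℕ => X ^ k * ((W * X ^ 4) ^ j / j !) :=
  (Real.summable_pow_div_factorial _).mul_left _

theorem hasSum_krylov (k : ℕ) (w x : ℂ) : HasSum (krylovTerm k w x) (krylov k w x) :=
  (Summable.of_norm_bounded (summable_krylovTerm_bound k ‖w‖ ‖x‖)
    (fun j => norm_krylovTerm_le le_rfl le_rfl j)).hasSum

theorem differentiable_krylov_left (k : ℕ) (x : ℂ) : Differentiable ℂ fun w => krylov k w x := by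
  intro w
  have hdiff : DifferentiableOn ℂ (fun w => krylov k w x) (Metric.ball 0 (‖w‖ + 1)) :=
    Complex.differentiableOn_tsum_of_summable_norm
      (summable_krylovTerm_bound k (‖w‖ + 1) ‖x‖)
      (fun j => by unfold krylovTerm; fun_prop) Metric.isOpen_ball
      (fun j z hz => norm_krylovTerm_le (mem_ball_zero_iff.1 hz).le le_rfl j)
  exact hdiff.differentiableAt (Metric.isOpen_ball.mem_nhds (by simp))

theorem differentiable_krylovTerm (k j : ℕ) (w : ℂ) :
    Differentiable ℂ fun x => krylovTerm k w x j := by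
  unfold krylovTerm
  fun_prop

theorem norm_krylovTerm_le_of_mem_ball {k : ℕ} {w z : ℂ} {X : ℝ} (j : ℕ)
    (hz : z ∈ Metric.ball (0 : ℂ) X) :
    ‖krylovTerm k w z j‖ ≤ X ^ k * ((‖w‖ * X ^ 4) ^ j / j !) :=
  norm_krylovTerm_le le_rfl (mem_ball_zero_iff.1 hz).le j

theorem differentiable_krylov (k : ℕ) (w : ℂ) : Differentiable ℂ (krylov k w) := by
  intro x
  have hdiff : DifferentiableOn ℂ (krylov k w) (Metric.ball 0 (‖x‖ + 1)) :=
    Complex.differentiableOn_tsum_of_summable_norm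
      (summable_krylovTerm_bound k ‖w‖ (‖x‖ + 1))
      (fun j => (differentiable_krylovTerm k j w).differentiableOn) Metric.isOpen_ball
      (fun j _ => norm_krylovTerm_le_of_mem_ball j)
  exact hdiff.differentiableAt (Metric.isOpen_ball.mem_nhds (by simp))

theorem hasSum_deriv_krylovTerm (k : ℕ) (w x : ℂ) :
    HasSum (fun j => deriv (fun x => krylovTerm k w x j) x) (deriv (krylov k w) x) :=
  Complex.hasSum_deriv_of_summable_norm (F := fun j x => krylovTerm k w x j)
    (summable_krylovTerm_bound k ‖w‖ (‖x‖ + 1))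
    (fun j => (differentiable_krylovTerm k j w).differentiableOn) Metric.isOpen_ball
    (fun j _ => norm_krylovTerm_le_of_mem_ball j) (by simp)

theorem deriv_krylovTerm_succ (k j : ℕ) (w x : ℂ) :
    deriv (fun x => krylovTerm (k + 1) w x j) x = krylovTerm k w x j := by
  have hderiv : HasDerivAt (fun x => krylovTerm (k + 1) w x j)
      (w ^ j * (((4 * j + k + 1 : ℕ) : ℂ) * x ^ (4 * j + k)) / ((4 * j + (k + 1))! : ℂ)) x :=
    ((hasDerivAt_pow (4 * j + k + 1) x).const_mul (w ^ j)).div_const _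
  have hsucc : ((4 * j + k + 1 : ℕ) : ℂ) ≠ 0 := Nat.cast_ne_zero.2 (Nat.succ_ne_zero _)
  have hfactorial : ((4 * j + k)! : ℂ) ≠ 0 := Nat.cast_ne_zero.2 (Nat.factorial_ne_zero _)
  rw [hderiv.deriv, krylovTerm, ← add_assoc, Nat.factorial_succ, Nat.cast_mul]
  field_simp

theorem hasDerivAt_krylov_succ (k : ℕ) (w x : ℂ) :
    HasDerivAt (krylov (k + 1) w) (krylov k w x) x := by
  have hsum := hasSum_deriv_krylovTerm (k + 1) w x
  simp only [deriv_krylovTerm_succ] at hsum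
  rw [(hasSum_krylov k w x).unique hsum]
  exact (differentiable_krylov (k + 1) w x).hasDerivAt

theorem krylovTerm_zero_succ (w x : ℂ) (j : ℕ) :
    krylovTerm 0 w x (j + 1) = w * krylovTerm 4 w x j := by
  rw [krylovTerm, krylovTerm, show 4 * (j + 1) + 0 = 4 * j + 4 by ring]
  ring

theorem krylov_zero_eq (w x : ℂ) : krylov 0 w x = 1 + w * krylov 4 w x := by
  refine (hasSum_krylov 0 w x).unique ?_
  rw [← hasSum_nat_add_iff' 1]
  simp only [krylovTerm_zero_succ, Finset.sum_range_one]
  simpa [krylovTerm] using (hasSum_krylov 4 w x).mul_left w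

theorem hasDerivAt_krylov_zero (w x : ℂ) : HasDerivAt (krylov 0 w) (w * krylov 3 w x) x := by
  rw [funext (krylov_zero_eq w)]
  exact ((hasDerivAt_krylov_succ 3 w x).const_mul w).const_add 1

theorem krylov_succ_apply_zero (k : ℕ) (w : ℂ) : krylov (k + 1) w 0 = 0 := by
  simp [krylov, krylovTerm]

theorem krylov_zero_apply_zero (w : ℂ) : krylov 0 w 0 = 1 := by
  rw [krylov_zero_eq, krylov_succ_apply_zero, mul_zero, add_zero]

theorem krylov_one_zero_apply_one : krylov 1 0 1 = 1 := by
  refine (hasSum_krylov 1 0 1).unique ?_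
  convert! hasSum_single (f := krylovTerm 1 0 1) 0 fun j hj => by simp [krylovTerm, hj]
  simp [krylovTerm]

theorem sinh_mul_eq_krylov (l x : ℂ) :
    Complex.sinh (l * x) = l * krylov 1 (l ^ 4) x + l ^ 3 * krylov 3 (l ^ 4) x := by
  refine (Complex.hasSum_sinh (l * x)).unique (HasSum.even_add_odd ?_ ?_)
  · convert! (hasSum_krylov 1 (l ^ 4) x).mul_left l using 2 with j
    rw [krylovTerm, show 2 * (2 * j) + 1 = 4 * j + 1 by ring]
    ring
  · convert! (hasSum_krylov 3 (l ^ 4) x).mul_left (l ^ 3) using 2 with j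
    rw [krylovTerm, show 2 * (2 * j + 1) + 1 = 4 * j + 3 by ring]
    ring

theorem sin_mul_eq_krylov (l x : ℂ) :
    Complex.sin (l * x) = l * krylov 1 (l ^ 4) x - l ^ 3 * krylov 3 (l ^ 4) x := by
  rw [sub_eq_add_neg, ← neg_mul]
  refine (Complex.hasSum_sin (l * x)).unique (HasSum.even_add_odd ?_ ?_)
  · convert! (hasSum_krylov 1 (l ^ 4) x).mul_left l using 2 with j
    have hsign : (-1 : ℂ) ^ (2 * j) = 1 := (even_two_mul j).neg_one_pow
    rw [krylovTerm, hsign, show 2 * (2 * j) + 1 = 4 * j + 1 by ring]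
    ring
  · convert! (hasSum_krylov 3 (l ^ 4) x).mul_left (-l ^ 3) using 2 with j
    have hsign : (-1 : ℂ) ^ (2 * j + 1) = -1 := (odd_two_mul_add_one j).neg_one_pow
    rw [krylovTerm, hsign, show 2 * (2 * j + 1) + 1 = 4 * j + 3 by ring]
    ring

/-- The solution `u` of `u'''' = w u` with `u(0) = u''(0) = 0`, `u'(0) = A`, `u'''(0) = B`,
with its derivatives: `hingedJet w A B i` is the `i`-th derivative for `i ≤ 4`. -/
def hingedJet (w A B : ℂ) : ℕ → ℝ → ℂ
  | 0, x => A * krylov 1 w x + B * krylov 3 w x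
  | 1, x => A * krylov 0 w x + B * krylov 2 w x
  | 2, x => A * (w * krylov 3 w x) + B * krylov 1 w x
  | 3, x => A * (w * krylov 2 w x) + B * krylov 0 w x
  | 4, x => w * (A * krylov 1 w x + B * krylov 3 w x)
  | _, _ => 0

theorem hasDerivAt_hingedJet (w A B : ℂ) {i : ℕ} (hi : i < 4) (x : ℝ) :
    HasDerivAt (hingedJet w A B i) (hingedJet w A B (i + 1) x) x := by
  have h0 := (hasDerivAt_krylov_zero w x).comp_ofReal
  have h1 := (hasDerivAt_krylov_succ 0 w x).comp_ofReal
  have h2 := (hasDerivAt_krylov_succ 1 w x).comp_ofReal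
  have h3 := (hasDerivAt_krylov_succ 2 w x).comp_ofReal
  interval_cases i
  · exact (h1.const_mul A).add (h3.const_mul B)
  · exact (h0.const_mul A).add (h2.const_mul B)
  · exact ((h3.const_mul w).const_mul A).add (h1.const_mul B)
  · refine (((h2.const_mul w).const_mul A).add (h0.const_mul B)).congr_deriv ?_
    simp only [hingedJet]
    ring

theorem continuous_hingedJet (w A B : ℂ) (i : ℕ) : Continuous (hingedJet w A B i) := by
  have hlt : ∀ i < 4, Continuous (hingedJet w A B i) := fun i hi =>
    continuous_iff_continuousAt.2 fun x => (hasDerivAt_hingedJet w A B hi x).continuousAt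
  match i with
  | 0 | 1 | 2 | 3 => exact hlt _ (by norm_num)
  | 4 => exact continuous_const.mul (hlt 0 (by norm_num))
  | _ + 5 => exact continuous_const

theorem hingedJet_four (w A B : ℂ) (x : ℝ) :
    hingedJet w A B 4 x = w * hingedJet w A B 0 x := rfl

theorem hingedJet_apply_zero (w A B : ℂ) :
    hingedJet w A B 0 0 = 0 ∧ hingedJet w A B 1 0 = A ∧ hingedJet w A B 2 0 = 0 ∧
      hingedJet w A B 3 0 = B := by
  simp [hingedJet, krylov_zero_apply_zero, krylov_succ_apply_zero]

theorem hingedJet_zero_zero (w : ℂ) (x : ℝ) : hingedJet w 0 0 0 x = 0 := by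
  simp [hingedJet]

/-- The characteristic function of the beam without load. -/
def freeChar (w : ℂ) : ℂ := krylov 1 w 1 ^ 2 - w * krylov 3 w 1 ^ 2

/-- The coefficient of the load in the characteristic function of the loaded beam. -/
def loadChar (ξ : ℝ) (w : ℂ) : ℂ :=
  krylov 1 w ξ * (krylov 3 w 1 * krylov 1 w (1 - ξ) - krylov 3 w (1 - ξ) * krylov 1 w 1) -
    krylov 3 w ξ * (krylov 1 w 1 * krylov 1 w (1 - ξ) - w * krylov 3 w 1 * krylov 3 w (1 - ξ))

theorem differentiable_freeChar : Differentiable ℂ freeChar := by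
  have h1 := differentiable_krylov_left 1 1
  have h3 := differentiable_krylov_left 3 1
  unfold freeChar
  fun_prop

theorem differentiable_loadChar (ξ : ℝ) : Differentiable ℂ (loadChar ξ) := by
  have h1 := differentiable_krylov_left 1
  have h3 := differentiable_krylov_left 3
  unfold loadChar
  exact ((h1 ξ).mul (((h3 1).mul (h1 (1 - ξ))).sub ((h3 (1 - ξ)).mul (h1 1)))).sub
    ((h3 ξ).mul (((h1 1).mul (h1 (1 - ξ))).sub ((differentiable_id.mul (h3 1)).mul (h3 (1 - ξ)))))

theorem freeChar_zero : freeChar 0 = 1 := by simp [freeChar, krylov_one_zero_apply_one]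

theorem sq_mul_freeChar (l : ℂ) : l ^ 2 * freeChar (l ^ 4) = Complex.sin l * Complex.sinh l := by
  have hsinh := sinh_mul_eq_krylov l 1
  have hsin := sin_mul_eq_krylov l 1
  rw [mul_one] at hsinh hsin
  rw [hsinh, hsin, freeChar]
  ring

theorem pow_five_mul_loadChar (ξ : ℝ) (l : ℂ) : 2 * l ^ 5 * loadChar ξ (l ^ 4) =
    Complex.sin (l * (1 - ξ)) * Complex.sin (l * ξ) * Complex.sinh l -
      Complex.sinh (l * (1 - ξ)) * Complex.sinh (l * ξ) * Complex.sin l := by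
  have hsinh := sinh_mul_eq_krylov l 1
  have hsin := sin_mul_eq_krylov l 1
  rw [mul_one] at hsinh hsin
  rw [hsinh, hsin, sinh_mul_eq_krylov, sin_mul_eq_krylov, sinh_mul_eq_krylov, sin_mul_eq_krylov,
    loadChar]
  ring

theorem IsSobolev.mono {k : ℕ} {c d c' d' : ℝ} {p : ℕ → ℝ → ℂ} (hp : IsSobolev k c d p)
    (hc : c ≤ c') (hcd : c' ≤ d') (hd : d' ≤ d) : IsSobolev k c' d' p := by
  have hc' : c' ∈ Icc c d := ⟨hc, hcd.trans hd⟩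
  have hint : ∀ i < k, ∀ y ∈ Icc c d, ∀ z ∈ Icc c d,
      IntervalIntegrable (p (i + 1)) volume y z := fun i hi y hy z hz => by
    refine (hp.1 i hi).1.mono_set ?_
    rw [uIcc_of_le (hy.1.trans hy.2)]
    exact ordConnected_Icc.uIcc_subset hy hz
  refine ⟨fun i hi => ⟨hint i hi c' hc' d' ⟨hc.trans hcd, hd⟩, fun x hx => ?_⟩,
    hp.2.mono_measure (Measure.restrict_mono (Ioo_subset_Ioo hc hd) le_rfl)⟩
  have hx' : x ∈ Icc c d := ⟨hc.trans hx.1, hx.2.trans hd⟩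
  have hcc : c ∈ Icc c d := ⟨le_rfl, hx'.1.trans hx'.2⟩
  rw [(hp.1 i hi).2 x hx', (hp.1 i hi).2 c' hc', ← intervalIntegral.integral_add_adjacent_intervals
    (hint i hi c hcc c' hc') (hint i hi c' hc' x hx'), add_assoc]

theorem IsSobolev.continuousOn {k : ℕ} {c d : ℝ} {p : ℕ → ℝ → ℂ} {i : ℕ}
    (hp : IsSobolev k c d p) (hi : i < k) (hcd : c ≤ d) : ContinuousOn (p i) (Icc c d) := by
  have hprimitive : ContinuousOn (fun x => ∫ t in c..x, p (i + 1) t) (uIcc c d) :=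
    intervalIntegral.continuousOn_primitive_interval' (hp.1 i hi).1 left_mem_uIcc
  rw [uIcc_of_le hcd] at hprimitive
  exact ((continuousOn_const (c := p i c)).add hprimitive).congr (hp.1 i hi).2

theorem IsSobolev.hasDerivWithinAt {k : ℕ} {c d : ℝ} {p : ℕ → ℝ → ℂ} {i : ℕ} {g : ℝ → ℂ}
    (hp : IsSobolev k c d p) (hi : i < k) (hcd : c ≤ d) (hg : ContinuousOn g (Icc c d))
    (h : p (i + 1) =ᵐ[volume.restrict (Ioo c d)] g) {x : ℝ} (hx : x ∈ Icc c d) :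
    HasDerivWithinAt (p i) (g x) (Icc c d) x := by
  let G : ℝ → ℂ := IccExtend hcd ((Icc c d).domRestrict g)
  have hG : Continuous G := (continuousOn_iff_continuous_domRestrict.1 hg).Icc_extend'
  have hGg : EqOn G g (Icc c d) := fun y hy => IccExtend_of_mem hcd _ hy
  have hprimitive : ∀ y ∈ Icc c d, p i y = p i c + ∫ t in c..y, G t := by
    intro y hy
    rw [(hp.1 i hi).2 y hy]
    congr 1
    refine intervalIntegral.integral_congr_ae_restrict ?_
    rw [uIoc_of_le hy.1]
    have hIoc : p (i + 1) =ᵐ[volume.restrict (Ioc c d)] g := by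
      rwa [← restrict_Ioo_eq_restrict_Ioc]
    filter_upwards [ae_restrict_of_ae_restrict_of_subset (Ioc_subset_Ioc_right hy.2) hIoc,
      ae_restrict_mem measurableSet_Ioc] with t hpt ht
    rw [hpt, hGg ⟨ht.1.le, ht.2.trans hy.2⟩]
  have hderiv : HasDerivAt (fun y => p i c + ∫ t in c..y, G t) (G x) x :=
    (hG.integral_hasStrictDerivAt c x).hasDerivAt.const_add _
  rw [← hGg hx]
  exact hderiv.hasDerivWithinAt.congr hprimitive (hprimitive x hx)

theorem eqOn_Icc_of_ae_eq {c d : ℝ} (hcd : c < d) {f g : ℝ → ℂ}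
    (hf : ContinuousOn f (Icc c d)) (hg : ContinuousOn g (Icc c d))
    (h : f =ᵐ[volume.restrict (Ioo c d)] g) : EqOn f g (Icc c d) :=
  (Measure.eqOn_Ioo_of_ae_eq volume h (hf.mono Ioo_subset_Icc_self)
    (hg.mono Ioo_subset_Icc_self)).of_subset_closure hf hg Ioo_subset_Icc_self
    (closure_Ioo hcd.ne).ge

theorem IsSobolev.eqOn_of_ae_eq {k m : ℕ} {c d : ℝ} {p q : ℕ → ℝ → ℂ}
    (hp : IsSobolev k c d p) (hq : IsSobolev m c d q) (hk : 0 < k) (hm : 0 < m) (hcd : c < d)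
    (h : p 0 =ᵐ[volume.restrict (Ioo c d)] q 0) : EqOn (p 0) (q 0) (Icc c d) :=
  eqOn_Icc_of_ae_eq hcd (hp.continuousOn hk hcd.le) (hq.continuousOn hm hcd.le) h

theorem IsSobolev.eqOn_succ {k m : ℕ} {c d : ℝ} {p q : ℕ → ℝ → ℂ} {i : ℕ}
    (hp : IsSobolev k c d p) (hq : IsSobolev m c d q) (hik : i + 1 < k) (him : i + 1 < m)
    (hcd : c < d) (h : EqOn (p i) (q i) (Icc c d)) :
    EqOn (p (i + 1)) (q (i + 1)) (Icc c d) := by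
  intro x hx
  have hpd := hp.hasDerivWithinAt (Nat.lt_of_succ_lt hik) hcd.le (hp.continuousOn hik hcd.le)
    (EventuallyEq.refl _ _) hx
  have hqd := hq.hasDerivWithinAt (Nat.lt_of_succ_lt him) hcd.le (hq.continuousOn him hcd.le)
    (EventuallyEq.refl _ _) hx
  exact (uniqueDiffOn_Icc hcd x hx).eq_deriv _ hpd (hqd.congr (fun y hy => h hy) (h hx))

theorem memLp_two_Ioo_of_continuous {f : ℝ → ℂ} (hf : Continuous f) (c d : ℝ) :
    MemLp f 2 (volume.restrict (Ioo c d)) := by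
  obtain ⟨M, hM⟩ := (isCompact_Icc (a := c) (b := d)).exists_bound_of_continuousOn hf.continuousOn
  refine MemLp.of_bound hf.aestronglyMeasurable M ?_
  filter_upwards [ae_restrict_mem measurableSet_Ioo] with x hx
  exact hM x (Ioo_subset_Icc_self hx)

theorem isSobolev_of_hasDerivAt {k : ℕ} {p : ℕ → ℝ → ℂ} (hc : ∀ i ≤ k, Continuous (p i))
    (h : ∀ i < k, ∀ x, HasDerivAt (p i) (p (i + 1) x) x) (c d : ℝ) : IsSobolev k c d p := by
  refine ⟨fun i hi => ⟨(hc (i + 1) hi).intervalIntegrable _ _, fun x _ => ?_⟩,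
    memLp_two_Ioo_of_continuous (hc k le_rfl) c d⟩
  rw [intervalIntegral.integral_eq_sub_of_hasDerivAt (fun y _ => h i hi y)
    ((hc (i + 1) hi).intervalIntegrable _ _), add_sub_cancel]

theorem isSobolev_hingedJet (w A B : ℂ) (c d : ℝ) : IsSobolev 4 c d (hingedJet w A B) :=
  isSobolev_of_hasDerivAt (fun i _ => continuous_hingedJet w A B i)
    (fun _ hi => hasDerivAt_hingedJet w A B hi) c d

theorem isSobolev_hingedJet_sub (w A B : ℂ) (ξ c d : ℝ) :
    IsSobolev 4 c d (fun i x => hingedJet w A B i (x - ξ)) :=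
  isSobolev_of_hasDerivAt
    (fun i _ => (continuous_hingedJet w A B i).comp (continuous_id.sub continuous_const))
    (fun _ hi x => (hasDerivAt_hingedJet w A B hi (x - ξ)).comp_sub_const x ξ) c d

/-- The function `P 0` solves `u'''' = w u` on `[c,d]`, with derivatives `P 1`, `P 2`, `P 3`. -/
def SolvesOn (w : ℂ) (c d : ℝ) (P : ℕ → ℝ → ℂ) : Prop :=
  ∀ x ∈ Icc c d, (∀ i < 3, HasDerivWithinAt (P i) (P (i + 1) x) (Icc c d) x) ∧
    HasDerivWithinAt (P 3) (w * P 0 x) (Icc c d) x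

theorem IsSobolev.solvesOn {w : ℂ} {c d : ℝ} {p : ℕ → ℝ → ℂ} (hp : IsSobolev 4 c d p)
    (hcd : c ≤ d) (h : p 4 =ᵐ[volume.restrict (Ioo c d)] fun x => w * p 0 x) :
    SolvesOn w c d p := fun _ hx =>
  ⟨fun _ hi => hp.hasDerivWithinAt (by omega) hcd (hp.continuousOn (by omega) hcd)
    (EventuallyEq.refl _ _) hx,
    hp.hasDerivWithinAt (by norm_num) hcd
      (continuousOn_const.mul (hp.continuousOn (by norm_num) hcd)) h hx⟩

theorem SolvesOn.add {w : ℂ} {c d : ℝ} {P Q : ℕ → ℝ → ℂ} (hP : SolvesOn w c d P)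
    (hQ : SolvesOn w c d Q) : SolvesOn w c d (P + Q) := fun x hx =>
  ⟨fun i hi => ((hP x hx).1 i hi).add ((hQ x hx).1 i hi),
    ((hP x hx).2.add (hQ x hx).2).congr_deriv (mul_add _ _ _).symm⟩

theorem solvesOn_hingedJet (w A B : ℂ) {c d : ℝ} (hcd : c ≤ d) :
    SolvesOn w c d (hingedJet w A B) :=
  (isSobolev_hingedJet w A B c d).solvesOn hcd (EventuallyEq.refl _ _)

theorem solvesOn_hingedJet_sub (w A B : ℂ) (ξ : ℝ) {c d : ℝ} (hcd : c ≤ d) :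
    SolvesOn w c d (fun i x => hingedJet w A B i (x - ξ)) :=
  (isSobolev_hingedJet_sub w A B ξ c d).solvesOn hcd (EventuallyEq.refl _ _)

/-- The right-hand side of the first order system for `(u, u', u'', u''')` which is equivalent to
`u'''' = w u`. -/
def companion (w : ℂ) : (Fin 4 → ℂ) →L[ℂ] (Fin 4 → ℂ) :=
  ContinuousLinearMap.pi
    ![ContinuousLinearMap.proj 1, ContinuousLinearMap.proj 2, ContinuousLinearMap.proj 3,
      w • ContinuousLinearMap.proj 0]

theorem SolvesOn.hasDerivWithinAt_companion {w : ℂ} {c d : ℝ} {P : ℕ → ℝ → ℂ}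
    (hP : SolvesOn w c d P) {x : ℝ} (hx : x ∈ Icc c d) :
    HasDerivWithinAt (fun t => fun j : Fin 4 => P j t) (companion w fun j : Fin 4 => P j x)
      (Icc c d) x := by
  rw [hasDerivWithinAt_pi]
  obtain ⟨hlow, htop⟩ := hP x hx
  intro j
  fin_cases j
  · exact hlow 0 (by norm_num)
  · exact hlow 1 (by norm_num)
  · exact hlow 2 (by norm_num)
  · exact htop

theorem SolvesOn.eqOn {w : ℂ} {c d : ℝ} {P Q : ℕ → ℝ → ℂ} (hP : SolvesOn w c d P)
    (hQ : SolvesOn w c d Q) (h : ∀ i < 4, P i c = Q i c) {i : ℕ} (hi : i < 4) :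
    EqOn (P i) (Q i) (Icc c d) := by
  have hcont : ∀ R, SolvesOn w c d R →
      ContinuousOn (fun t => fun j : Fin 4 => R j t) (Icc c d) :=
    fun R hR t ht => (hR.hasDerivWithinAt_companion ht).continuousWithinAt
  have hderiv : ∀ R, SolvesOn w c d R → ∀ t ∈ Ico c d, HasDerivWithinAt
      (fun t => fun j : Fin 4 => R j t) (companion w fun j : Fin 4 => R j t) (Ici t) t :=
    fun R hR t ht => (hR.hasDerivWithinAt_companion (Ico_subset_Icc_self ht)).mono_of_mem_nhdsWithin
      (Icc_mem_nhdsGE_of_mem ht)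
  have hEq := ODE_solution_unique_of_mem_Icc_right (v := fun _ => companion w)
    (s := fun _ => univ) (fun t _ => (companion w).lipschitz.lipschitzOnWith)
    (hcont P hP) (hderiv P hP) (fun _ _ => mem_univ _)
    (hcont Q hQ) (hderiv Q hQ) (fun _ _ => mem_univ _) (funext fun j => h j j.2)
  exact fun x hx => congrFun (hEq hx) ⟨i, hi⟩

theorem eq_zero_of_hingedJet_eqOn_zero {w A B : ℂ} {d : ℝ} (hd : 0 < d)
    (h : EqOn (hingedJet w A B 0) 0 (Icc 0 d)) : A = 0 ∧ B = 0 := by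
  have hjet := isSobolev_hingedJet w A B 0 d
  have hzero : IsSobolev 4 0 d 0 := IsSobolev.zero _ _ _
  have h1 := hjet.eqOn_succ hzero (by norm_num) (by norm_num) hd h
  have h2 := hjet.eqOn_succ hzero (by norm_num) (by norm_num) hd h1
  have h3 := hjet.eqOn_succ hzero (by norm_num) (by norm_num) hd h2
  obtain ⟨-, hA, -, hB⟩ := hingedJet_apply_zero w A B
  exact ⟨hA.symm.trans (h1 (left_mem_Icc.2 hd.le)), hB.symm.trans (h3 (left_mem_Icc.2 hd.le))⟩

/-- A beam mode: `l` and `r` are a solution of `u'''' = w u` on `[0,ξ]` and on `[ξ,1]` with its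
derivatives, hinged at `0` and `1`, which is `C²` at `ξ` and whose third derivative jumps there by
`-κ u(ξ)`. -/
structure IsLoadedMode (κ w : ℂ) (ξ : ℝ) (l r : ℕ → ℝ → ℂ) : Prop where
  left : SolvesOn w 0 ξ l
  right : SolvesOn w ξ 1 r
  left_hinged : l 0 0 = 0 ∧ l 2 0 = 0
  right_hinged : r 0 1 = 0 ∧ r 2 1 = 0
  match_at : ∀ i < 3, r i ξ = l i ξ
  jump : r 3 ξ - l 3 ξ = -(κ * l 0 ξ)

/-- The conditions on the coefficients `A = u'(0)`, `B = u'''(0)` and on the jump `C` of the third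
derivative at `ξ` under which they belong to a beam mode: hinges at `1`, and the load at `ξ`. -/
def LoadEq (κ : ℂ) (ξ : ℝ) (w A B C : ℂ) : Prop :=
  hingedJet w A B 0 1 + hingedJet w 0 C 0 (1 - ξ) = 0 ∧
    hingedJet w A B 2 1 + hingedJet w 0 C 2 (1 - ξ) = 0 ∧
    C = -(κ * hingedJet w A B 0 ξ)

/-- The matrix of the linear system `LoadEq` in the unknowns `A`, `B`, `C`. -/
def loadMatrix (κ : ℂ) (ξ : ℝ) (w : ℂ) : Matrix (Fin 3) (Fin 3) ℂ :=
  !![krylov 1 w 1, krylov 3 w 1, krylov 3 w (1 - ξ);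
    w * krylov 3 w 1, krylov 1 w 1, krylov 1 w (1 - ξ);
    κ * krylov 1 w ξ, κ * krylov 3 w ξ, 1]

theorem det_loadMatrix (κ : ℂ) (ξ : ℝ) (w : ℂ) :
    (loadMatrix κ ξ w).det = freeChar w + κ * loadChar ξ w := by
  rw [loadMatrix, Matrix.det_fin_three, freeChar, loadChar]
  simp only [Matrix.of_apply, Matrix.cons_val]
  ring

theorem loadMatrix_mulVec_eq_zero_iff {κ : ℂ} {ξ : ℝ} {w A B C : ℂ} :
    (loadMatrix κ ξ w).mulVec ![A, B, C] = 0 ↔ LoadEq κ ξ w A B C := by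
  simp only [loadMatrix, LoadEq, hingedJet, funext_iff, Fin.forall_fin_succ, Matrix.mulVec,
    dotProduct, Fin.sum_univ_succ, Matrix.of_apply, Matrix.cons_val_zero, Matrix.cons_val_succ,
    Finset.univ_eq_empty, Finset.sum_empty, Pi.zero_apply, IsEmpty.forall_iff, and_true,
    Complex.ofReal_one, Complex.ofReal_sub]
  refine and_congr ?_ (and_congr ?_ ?_) <;> constructor <;> intro h <;> linear_combination h

theorem exists_loadEq_iff (κ : ℂ) (ξ : ℝ) (w : ℂ) :
    (∃ A B C : ℂ, (A ≠ 0 ∨ B ≠ 0) ∧ LoadEq κ ξ w A B C) ↔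
      freeChar w + κ * loadChar ξ w = 0 := by
  rw [← det_loadMatrix, ← Matrix.exists_mulVec_eq_zero_iff]
  constructor
  · rintro ⟨A, B, C, hne, h⟩
    refine ⟨![A, B, C], fun hzero => ?_, loadMatrix_mulVec_eq_zero_iff.2 h⟩
    exact hne.elim (fun hA => hA (congrFun hzero 0)) (fun hB => hB (congrFun hzero 1))
  · rintro ⟨v, hne, h⟩
    obtain ⟨A, B, C, rfl⟩ : ∃ A B C, v = ![A, B, C] :=
      ⟨v 0, v 1, v 2, by ext j; fin_cases j <;> rfl⟩
    rw [loadMatrix_mulVec_eq_zero_iff] at h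
    refine ⟨A, B, C, ?_, h⟩
    by_contra! hzero
    obtain ⟨rfl, rfl⟩ := hzero
    obtain rfl : C = 0 := by simpa [hingedJet_zero_zero] using h.2.2
    exact hne (by ext j; fin_cases j <;> rfl)

theorem IsLoadedMode.eqOn_left {κ w : ℂ} {ξ : ℝ} {l r : ℕ → ℝ → ℂ}
    (h : IsLoadedMode κ w ξ l r) (hξ : 0 ≤ ξ) {i : ℕ} (hi : i < 4) :
    EqOn (l i) (hingedJet w (l 1 0) (l 3 0) i) (Icc 0 ξ) := by
  obtain ⟨h0, h1, h2, h3⟩ := hingedJet_apply_zero w (l 1 0) (l 3 0)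
  refine h.left.eqOn (solvesOn_hingedJet w _ _ hξ) (fun i hi => ?_) hi
  interval_cases i
  exacts [h.left_hinged.1.trans h0.symm, h1.symm, h.left_hinged.2.trans h2.symm, h3.symm]

theorem IsLoadedMode.eqOn_right {κ w : ℂ} {ξ : ℝ} {l r : ℕ → ℝ → ℂ}
    (h : IsLoadedMode κ w ξ l r) (hξ : ξ ∈ Icc (0 : ℝ) 1) {i : ℕ} (hi : i < 4) :
    EqOn (r i) (fun x => hingedJet w (l 1 0) (l 3 0) i x +
      hingedJet w 0 (r 3 ξ - l 3 ξ) i (x - ξ)) (Icc ξ 1) := by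
  obtain ⟨h0, h1, h2, h3⟩ := hingedJet_apply_zero w 0 (r 3 ξ - l 3 ξ)
  refine h.right.eqOn ((solvesOn_hingedJet w _ _ hξ.2).add (solvesOn_hingedJet_sub w 0 _ ξ hξ.2))
    (fun i hi => ?_) hi
  simp only [Pi.add_apply, sub_self]
  rw [← h.eqOn_left hξ.1 hi (right_mem_Icc.2 hξ.1)]
  interval_cases i
  · rw [h.match_at 0 (by norm_num), h0, add_zero]
  · rw [h.match_at 1 (by norm_num), h1, add_zero]
  · rw [h.match_at 2 (by norm_num), h2, add_zero]
  · rw [h3, add_sub_cancel]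

theorem IsLoadedMode.loadEq {κ w : ℂ} {ξ : ℝ} {l r : ℕ → ℝ → ℂ}
    (h : IsLoadedMode κ w ξ l r) (hξ : ξ ∈ Icc (0 : ℝ) 1) :
    LoadEq κ ξ w (l 1 0) (l 3 0) (r 3 ξ - l 3 ξ) := by
  have h1 : (1 : ℝ) ∈ Icc ξ 1 := right_mem_Icc.2 hξ.2
  refine ⟨?_, ?_, ?_⟩
  · exact (h.eqOn_right hξ (by norm_num) h1).symm.trans h.right_hinged.1
  · exact (h.eqOn_right hξ (by norm_num) h1).symm.trans h.right_hinged.2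
  · rw [← h.eqOn_left hξ.1 (by norm_num) (right_mem_Icc.2 hξ.1), h.jump]

theorem IsLoadedMode.eqOn_zero {κ w : ℂ} {ξ : ℝ} {l r : ℕ → ℝ → ℂ}
    (h : IsLoadedMode κ w ξ l r) (hξ : ξ ∈ Icc (0 : ℝ) 1) (h1 : l 1 0 = 0) (h3 : l 3 0 = 0) :
    EqOn (l 0) 0 (Icc 0 ξ) ∧ EqOn (r 0) 0 (Icc ξ 1) := by
  have hjump : r 3 ξ - l 3 ξ = 0 := by
    simpa [h1, h3, hingedJet_zero_zero] using (h.loadEq hξ).2.2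
  constructor <;> intro x hx
  · rw [h.eqOn_left hξ.1 (by norm_num) hx, h1, h3, hingedJet_zero_zero, Pi.zero_apply]
  · simp only [h.eqOn_right hξ (i := 0) (by norm_num) hx, h1, h3, hjump, hingedJet_zero_zero,
      add_zero, Pi.zero_apply]

/-- The fourth power `λ ^ 4` of the parameter `λ` which belongs to the eigenvalue `μ`. -/
def lamPowFour (a b : ℝ) (μ : ℂ) : ℂ := -((b : ℂ) * μ + μ ^ 2) / (a : ℂ)

theorem mul_lamPowFour {a : ℝ} (ha : a ≠ 0) (b : ℝ) (μ : ℂ) :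
    (a : ℂ) * lamPowFour a b μ = -(b * μ + μ ^ 2) :=
  mul_div_cancel₀ _ (Complex.ofReal_ne_zero.2 ha)

theorem coeFn_smul_ae_eq {f : L2} {g : ℝ → ℂ} (z : ℂ)
    (h : (f : ℝ → ℂ) =ᵐ[volume.restrict (Ioo 0 1)] g) :
    ((z • f : L2) : ℝ → ℂ) =ᵐ[volume.restrict (Ioo 0 1)] fun x => z * g x := by
  filter_upwards [Lp.coeFn_smul z f, h] with x hsmul hfg
  rw [hsmul, Pi.smul_apply, hfg, smul_eq_mul]

theorem ae_restrict_Ioo_of_split {c d : ℝ} {P : ℝ → Prop} (ξ : ℝ)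
    (hl : ∀ᵐ x ∂volume.restrict (Ioo c ξ), P x) (hr : ∀ᵐ x ∂volume.restrict (Ioo ξ d), P x) :
    ∀ᵐ x ∂volume.restrict (Ioo c d), P x := by
  rw [ae_restrict_iff' measurableSet_Ioo] at hl hr ⊢
  filter_upwards [hl, hr, Measure.ae_ne volume ξ] with x hlx hrx hne hx
  exact hne.lt_or_gt.elim (fun hlt => hlx ⟨hx.1, hlt⟩) (fun hgt => hrx ⟨hgt, hx.2⟩)

theorem IsSobolev.solvesOn_lamPowFour {a : ℝ} (ha : a ≠ 0) {b c d : ℝ} {μ : ℂ} {u v F : ℝ → ℂ}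
    {p : ℕ → ℝ → ℂ} (hp : IsSobolev 4 c d p) (hcd : c ≤ d)
    (hu : u =ᵐ[volume.restrict (Ioo c d)] p 0)
    (hv : v =ᵐ[volume.restrict (Ioo c d)] fun x => μ * u x)
    (hF : F =ᵐ[volume.restrict (Ioo c d)] fun x => μ * v x)
    (hFv : F =ᵐ[volume.restrict (Ioo c d)] fun x => -(a : ℂ) * p 4 x - (b : ℂ) * v x) :
    SolvesOn (lamPowFour a b μ) c d p := by
  refine hp.solvesOn hcd ?_
  filter_upwards [hu, hv, hF, hFv] with x hux hvx hFx hFvx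
  apply mul_left_cancel₀ (Complex.ofReal_ne_zero.2 ha)
  rw [hux] at hvx
  linear_combination hFvx - hFx - (b + μ) * hvx - p 0 x * mul_lamPowFour ha b μ

theorem InGraph.exists_isLoadedMode {a b α ξ : ℝ} (ha : a ≠ 0) (hξ : ξ ∈ Ioo 0 1) {μ : ℂ}
    {U : Energy} (h : InGraph a b α ξ U (μ • U)) :
    ∃ l r, IsLoadedMode ((α / a : ℝ) * μ) (lamPowFour a b μ) ξ l r ∧
      ((U.1 : L2) : ℝ → ℂ) =ᵐ[volume.restrict (Ioo 0 ξ)] l 0 ∧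
      ((U.1 : L2) : ℝ → ℂ) =ᵐ[volume.restrict (Ioo ξ 1)] r 0 := by
  obtain ⟨hξ0, hξ1⟩ := hξ
  obtain ⟨hv, l, r, q, hl, hr, hq, hul, hur, hvq, hl2, hr2, hmatch2, hjump, hFl, hFr⟩ := h
  obtain ⟨p, hp, hp0, hp1, hup⟩ := U.1.2
  have hvu : U.2 = μ • (U.1 : L2) := hv.symm
  have hvae : (U.2 : ℝ → ℂ) =ᵐ[volume.restrict (Ioo 0 1)] fun x => μ * (U.1 : L2) x := by
    rw [hvu]
    exact coeFn_smul_ae_eq μ EventuallyEq.rfl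
  have hFae := coeFn_smul_ae_eq (f := U.2) μ EventuallyEq.rfl
  have hpl := hp.mono le_rfl hξ0.le hξ1.le
  have hpr := hp.mono hξ0.le hξ1.le le_rfl
  have hl0 : EqOn (l 0) (p 0) (Icc 0 ξ) := hl.eqOn_of_ae_eq hpl (by norm_num) (by norm_num) hξ0
    (hul.symm.trans (ae_restrict_of_Ioo le_rfl hξ1.le hup))
  have hr0 : EqOn (r 0) (p 0) (Icc ξ 1) := hr.eqOn_of_ae_eq hpr (by norm_num) (by norm_num) hξ1
    (hur.symm.trans (ae_restrict_of_Ioo hξ0.le le_rfl hup))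
  have hl1 := hl.eqOn_succ hpl (by norm_num) (by norm_num) hξ0 hl0
  have hr1 := hr.eqOn_succ hpr (by norm_num) (by norm_num) hξ1 hr0
  have hq0 : EqOn (q 0) ((μ • p) 0) (Icc 0 1) := by
    refine hq.eqOn_of_ae_eq (hp.smul μ) (by norm_num) (by norm_num) one_pos (hvq.symm.trans ?_)
    filter_upwards [hvae, hup] with x hvx hux
    rw [hvx, hux, Pi.smul_apply, Pi.smul_apply, smul_eq_mul]
  have hξl : ξ ∈ Icc 0 ξ := right_mem_Icc.2 hξ0.le
  have hξr : ξ ∈ Icc ξ 1 := left_mem_Icc.2 hξ1.le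
  refine ⟨l, r, ⟨?_, ?_, ⟨?_, hl2⟩, ⟨?_, hr2⟩, fun i hi => ?_, ?_⟩, hul, hur⟩
  · exact hl.solvesOn_lamPowFour ha hξ0.le hul (ae_restrict_of_Ioo le_rfl hξ1.le hvae)
      (ae_restrict_of_Ioo le_rfl hξ1.le hFae) hFl
  · exact hr.solvesOn_lamPowFour ha hξ1.le hur (ae_restrict_of_Ioo hξ0.le le_rfl hvae)
      (ae_restrict_of_Ioo hξ0.le le_rfl hFae) hFr
  · rw [hl0 (left_mem_Icc.2 hξ0.le), hp0]
  · rw [hr0 (right_mem_Icc.2 hξ1.le), hp1]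
  · interval_cases i
    exacts [(hr0 hξr).trans (hl0 hξl).symm, (hr1 hξr).trans (hl1 hξl).symm, hmatch2.symm]
  · rw [hjump, hq0 ⟨hξ0.le, hξ1.le⟩, hl0 hξl, Pi.smul_apply, Pi.smul_apply, smul_eq_mul]
    ring

theorem IsEigenvector.inGraph {a b α : ℝ} {ξ : Ioo (0 : ℝ) 1} {μ : ℂ} {U : (A a b α ξ).domain}
    (h : IsEigenvector (A a b α ξ) μ U) : InGraph a b α ξ U (μ • (U : Energy)) := by
  rw [← mem_graph_A_iff, ← h.2]
  exact LinearPMap.mem_graph _ U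

theorem exists_loadEq_of_isEigenvalue {a b α : ℝ} (ha : a ≠ 0) (ξ : Ioo (0 : ℝ) 1) {μ : ℂ}
    (h : IsEigenvalue (Beam.A a b α ξ) μ) :
    ∃ A B C : ℂ, (A ≠ 0 ∨ B ≠ 0) ∧ LoadEq ((α / a : ℝ) * μ) ξ (lamPowFour a b μ) A B C := by
  obtain ⟨U, hU⟩ := h
  have hξ : (ξ : ℝ) ∈ Icc (0 : ℝ) 1 := Ioo_subset_Icc_self ξ.2
  obtain ⟨l, r, hmode, hul, hur⟩ := hU.inGraph.exists_isLoadedMode ha ξ.2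
  refine ⟨l 1 0, l 3 0, _, ?_, hmode.loadEq hξ⟩
  by_contra! hzero
  obtain ⟨hl0, hr0⟩ := hmode.eqOn_zero hξ hzero.1 hzero.2
  have hu : ((U : Energy).1 : L2) = 0 := by
    refine Lp.ext (EventuallyEq.trans (ae_restrict_Ioo_of_split (ξ : ℝ) ?_ ?_)
      (Lp.coeFn_zero ℂ 2 _).symm)
    · filter_upwards [hul, ae_restrict_mem measurableSet_Ioo] with x hux hx
      exact hux.trans (hl0 (Ioo_subset_Icc_self hx))
    · filter_upwards [hur, ae_restrict_mem measurableSet_Ioo] with x hux hx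
      exact hux.trans (hr0 (Ioo_subset_Icc_self hx))
  have hv : (U : Energy).2 = μ • ((U : Energy).1 : L2) := hU.inGraph.1.symm
  rw [hu, smul_zero] at hv
  exact hU.1 (Subtype.ext (Prod.ext (Subtype.ext hu) hv))

/-- The solution of `u'''' = w u` with `u(0) = u''(0) = 0`, `u'(0) = A`, `u'''(0) = B` whose third
derivative jumps by `C` at `ξ`; as in `hingedJet`, the index `i` is the order of the derivative. -/
def profile (ξ : ℝ) (w A B C : ℂ) (i : ℕ) (x : ℝ) : ℂ :=
  hingedJet w A B i x + if ξ ≤ x then hingedJet w 0 C i (x - ξ) else 0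

theorem profile_of_lt {ξ x : ℝ} (hx : x < ξ) (w A B C : ℂ) (i : ℕ) :
    profile ξ w A B C i x = hingedJet w A B i x := by
  rw [profile, if_neg hx.not_ge, add_zero]

theorem profile_of_le {ξ x : ℝ} (hx : ξ ≤ x) (w A B C : ℂ) (i : ℕ) :
    profile ξ w A B C i x = hingedJet w A B i x + hingedJet w 0 C i (x - ξ) := by
  rw [profile, if_pos hx]

theorem hasDerivAt_ite_le {E : Type*} [NormedAddCommGroup E] [NormedSpace ℝ E] {g g' : ℝ → E}
    {ξ : ℝ} (hg : ∀ x, HasDerivAt g (g' x) x) (h : g ξ = 0) (h' : g' ξ = 0) (x : ℝ) :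
    HasDerivAt (fun x => if ξ ≤ x then g x else 0) (if ξ ≤ x then g' x else 0) x := by
  rcases lt_trichotomy x ξ with hlt | rfl | hgt
  · rw [if_neg hlt.not_ge]
    refine (hasDerivAt_const x (0 : E)).congr_of_eventuallyEq ?_
    filter_upwards [Iio_mem_nhds hlt] with y hy
    exact if_neg (not_le.2 hy)
  · rw [if_pos le_rfl, h', ← hasDerivWithinAt_univ, ← Iic_union_Ici (a := x)]
    refine HasDerivWithinAt.union ?_ ?_
    · refine (hasDerivWithinAt_const x (Iic x) (0 : E)).congr (fun y hy => ?_) (by simp [h])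
      split_ifs with hxy
      · rw [le_antisymm hy hxy, h]
      · rfl
    · exact ((hg x).hasDerivWithinAt.congr_deriv h').congr (fun y hy => if_pos hy) (if_pos le_rfl)
  · rw [if_pos hgt.le]
    refine (hg x).congr_of_eventuallyEq ?_
    filter_upwards [Ioi_mem_nhds hgt] with y hy
    exact if_pos (le_of_lt hy)

theorem hingedJet_zero_left_apply_zero (w C : ℂ) {i : ℕ} (hi : i < 3) :
    hingedJet w 0 C i 0 = 0 := by
  obtain ⟨h0, h1, h2, -⟩ := hingedJet_apply_zero w 0 C
  interval_cases i
  exacts [h0, h1, h2]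

theorem hasDerivAt_profile (ξ : ℝ) (w A B C : ℂ) {i : ℕ} (hi : i < 2) (x : ℝ) :
    HasDerivAt (profile ξ w A B C i) (profile ξ w A B C (i + 1) x) x := by
  refine (hasDerivAt_hingedJet w A B (by omega) x).add (hasDerivAt_ite_le
    (fun x => (hasDerivAt_hingedJet w 0 C (by omega) (x - ξ)).comp_sub_const x ξ) ?_ ?_ x)
  · rw [sub_self, hingedJet_zero_left_apply_zero w C (by omega)]
  · rw [sub_self, hingedJet_zero_left_apply_zero w C (by omega)]

theorem continuous_profile (ξ : ℝ) (w A B C : ℂ) {i : ℕ} (hi : i < 3) :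
    Continuous (profile ξ w A B C i) := by
  refine (continuous_hingedJet w A B i).add (Continuous.if_le ((continuous_hingedJet w 0 C i).comp
    (continuous_id.sub continuous_const)) continuous_const continuous_const continuous_id ?_)
  rintro x rfl
  exact (congrArg _ (sub_self _)).trans (hingedJet_zero_left_apply_zero w C hi)

theorem isSobolev_profile (ξ : ℝ) (w A B C : ℂ) : IsSobolev 2 0 1 (profile ξ w A B C) :=
  isSobolev_of_hasDerivAt (fun _ hi => continuous_profile ξ w A B C (Nat.lt_succ_of_le hi))
    (fun _ hi x => hasDerivAt_profile ξ w A B C hi x) 0 1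

theorem eq_zero_of_profile_ae_eq_zero {ξ : ℝ} (hξ : ξ ∈ Ioo (0 : ℝ) 1) {w A B C : ℂ}
    (h : profile ξ w A B C 0 =ᵐ[volume.restrict (Ioo 0 1)] 0) : A = 0 ∧ B = 0 := by
  refine eq_zero_of_hingedJet_eqOn_zero hξ.1 (eqOn_Icc_of_ae_eq hξ.1
    (continuous_hingedJet w A B 0).continuousOn continuousOn_const ?_)
  filter_upwards [ae_restrict_of_Ioo le_rfl hξ.2.le h, ae_restrict_mem measurableSet_Ioo]
    with x hzero hx
  rwa [profile_of_lt hx.2] at hzero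

theorem exists_mem_V_ae_eq_profile {κ w A B C : ℂ} {ξ : ℝ} (hξ : ξ ∈ Ioo (0 : ℝ) 1)
    (h : LoadEq κ ξ w A B C) :
    ∃ f : V, ((f : L2) : ℝ → ℂ) =ᵐ[volume.restrict (Ioo 0 1)] profile ξ w A B C 0 := by
  have hae := (memLp_two_Ioo_of_continuous
    (continuous_profile ξ w A B C (i := 0) (by norm_num)) 0 1).coeFn_toLp
  refine ⟨⟨_, profile ξ w A B C, isSobolev_profile ξ w A B C, ?_, ?_, hae⟩, hae⟩
  · rw [profile_of_lt hξ.1, (hingedJet_apply_zero w A B).1]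
  · rw [profile_of_le hξ.2.le, h.1]

theorem ae_eq_of_eq_lamPowFour_mul {a : ℝ} (ha : a ≠ 0) {b : ℝ} {μ : ℂ} {ν : Measure ℝ}
    {u v F : ℝ → ℂ} {p : ℕ → ℝ → ℂ} (hp : ∀ x, p 4 x = lamPowFour a b μ * p 0 x)
    (hu : u =ᵐ[ν] p 0) (hv : v =ᵐ[ν] fun x => μ * u x) (hF : F =ᵐ[ν] fun x => μ * v x) :
    F =ᵐ[ν] fun x => -(a : ℂ) * p 4 x - (b : ℂ) * v x := by
  filter_upwards [hu, hv, hF] with x hux hvx hFx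
  rw [hux] at hvx
  rw [hp]
  linear_combination hFx + (b + μ) * hvx + p 0 x * mul_lamPowFour ha b μ

theorem inGraph_of_ae_eq_profile {a : ℝ} (ha : a ≠ 0) {b α ξ : ℝ} (hξ : ξ ∈ Ioo (0 : ℝ) 1)
    {μ A B C : ℂ} (hload : LoadEq ((α / a : ℝ) * μ) ξ (lamPowFour a b μ) A B C) {f : V}
    (hf : ((f : L2) : ℝ → ℂ) =ᵐ[volume.restrict (Ioo 0 1)]
      profile ξ (lamPowFour a b μ) A B C 0) :
    InGraph a b α ξ (f, μ • (f : L2)) (μ • (f, μ • (f : L2))) := by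
  obtain ⟨hξ0, hξ1⟩ := hξ
  have hv := coeFn_smul_ae_eq (f := f) μ EventuallyEq.rfl
  have hF := coeFn_smul_ae_eq (f := μ • (f : L2)) μ EventuallyEq.rfl
  have hul : ((f : L2) : ℝ → ℂ) =ᵐ[volume.restrict (Ioo 0 ξ)]
      hingedJet (lamPowFour a b μ) A B 0 := by
    filter_upwards [ae_restrict_of_Ioo le_rfl hξ1.le hf, ae_restrict_mem measurableSet_Ioo]
      with x hfx hx
    rw [hfx, profile_of_lt hx.2]
  have hur : ((f : L2) : ℝ → ℂ) =ᵐ[volume.restrict (Ioo ξ 1)]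
      (hingedJet (lamPowFour a b μ) A B +
        fun i x => hingedJet (lamPowFour a b μ) 0 C i (x - ξ)) 0 := by
    filter_upwards [ae_restrict_of_Ioo hξ0.le le_rfl hf, ae_restrict_mem measurableSet_Ioo]
      with x hfx hx
    rw [hfx, profile_of_le hx.1.le, Pi.add_apply, Pi.add_apply]
  refine ⟨rfl, _, _, _, isSobolev_hingedJet _ A B 0 ξ,
    (isSobolev_hingedJet _ A B ξ 1).add (isSobolev_hingedJet_sub _ 0 C ξ ξ 1),
    (isSobolev_profile _ _ _ _ _).smul μ, hul, hur, coeFn_smul_ae_eq μ hf,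
    (hingedJet_apply_zero _ A B).2.2.1, hload.2.1, ?_, ?_, ?_, ?_⟩
  · simp only [Pi.add_apply, sub_self, hingedJet_zero_left_apply_zero _ C (i := 2) (by norm_num),
      add_zero]
  · simp only [Pi.add_apply, Pi.smul_apply, smul_eq_mul, sub_self,
      (hingedJet_apply_zero _ 0 C).2.2.2, profile_of_le le_rfl,
      hingedJet_zero_left_apply_zero _ C (i := 0) (by norm_num), add_zero]
    linear_combination hload.2.2
  · exact ae_eq_of_eq_lamPowFour_mul ha (hingedJet_four _ A B) hul
      (ae_restrict_of_Ioo le_rfl hξ1.le hv) (ae_restrict_of_Ioo le_rfl hξ1.le hF)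
  · refine ae_eq_of_eq_lamPowFour_mul ha (fun x => ?_) hur
      (ae_restrict_of_Ioo hξ0.le le_rfl hv) (ae_restrict_of_Ioo hξ0.le le_rfl hF)
    simp only [Pi.add_apply, hingedJet_four, mul_add]

theorem isEigenfunction_profile {a : ℝ} (ha : a ≠ 0) {b α : ℝ} (ξ : Ioo (0 : ℝ) 1) {μ A B C : ℂ}
    (hne : A ≠ 0 ∨ B ≠ 0) (hload : LoadEq ((α / a : ℝ) * μ) ξ (lamPowFour a b μ) A B C) :
    IsEigenfunction (Beam.A a b α ξ) μ fun x => (profile ξ (lamPowFour a b μ) A B C 0 x,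
      μ * profile ξ (lamPowFour a b μ) A B C 0 x) := by
  obtain ⟨f, hf⟩ := exists_mem_V_ae_eq_profile ξ.2 hload
  have hgraph := inGraph_of_ae_eq_profile ha ξ.2 hload hf
  rw [← mem_graph_A_iff, LinearPMap.mem_graph_iff] at hgraph
  obtain ⟨U, hU, hTU⟩ := hgraph
  refine ⟨U, ⟨?_, by rw [hTU, hU]⟩, by rwa [hU], by rw [hU]; exact coeFn_smul_ae_eq μ hf⟩
  rintro rfl
  have hf0 : f = 0 := congrArg Prod.fst hU.symm
  rw [hf0] at hf
  obtain ⟨hA, hB⟩ := eq_zero_of_profile_ae_eq_zero ξ.2 (hf.symm.trans (Lp.coeFn_zero ℂ 2 _))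
  exact hne.elim (fun h => h hA) (fun h => h hB)

theorem IsEigenfunction.isEigenvalue {T : Energy →ₗ.[ℂ] Energy} {μ : ℂ} {f : ℝ → ℂ × ℂ}
    (h : IsEigenfunction T μ f) : IsEigenvalue T μ :=
  h.imp fun _ hU => hU.1

theorem IsEigenfunction.const_smul {T : Energy →ₗ.[ℂ] Energy} {μ : ℂ} {f : ℝ → ℂ × ℂ}
    (h : IsEigenfunction T μ f) {z : ℂ} (hz : z ≠ 0) : IsEigenfunction T μ (z • f) := by
  obtain ⟨U, ⟨hU, hTU⟩, h1, h2⟩ := h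
  refine ⟨z • U, ⟨smul_ne_zero hz hU, ?_⟩, coeFn_smul_ae_eq z h1, coeFn_smul_ae_eq z h2⟩
  rw [LinearPMap.map_smul, hTU, smul_comm, Submodule.coe_smul]

/-- The coefficient of `α` in the characteristic function of the beam operator. -/
def loadCoeff (a b ξ : ℝ) (μ : ℂ) : ℂ := μ / a * loadChar ξ (lamPowFour a b μ)

theorem isEigenvalue_iff {a : ℝ} (ha : a ≠ 0) (b α : ℝ) (ξ : Ioo (0 : ℝ) 1) (μ : ℂ) :
    IsEigenvalue (A a b α ξ) μ ↔
      freeChar (lamPowFour a b μ) + α * loadCoeff a b ξ μ = 0 := by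
  have hcoeff : (α : ℂ) * loadCoeff a b ξ μ =
      (α / a : ℝ) * μ * loadChar ξ (lamPowFour a b μ) := by
    rw [loadCoeff, Complex.ofReal_div]
    ring
  rw [hcoeff, ← exists_loadEq_iff]
  refine ⟨exists_loadEq_of_isEigenvalue ha ξ, ?_⟩
  rintro ⟨A, B, C, hne, hload⟩
  exact (isEigenfunction_profile ha ξ hne hload).isEigenvalue

theorem differentiable_lamPowFour (a b : ℝ) : Differentiable ℂ (lamPowFour a b) := by
  unfold lamPowFour
  fun_prop

theorem differentiable_loadCoeff (a b ξ : ℝ) : Differentiable ℂ (loadCoeff a b ξ) := by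
  have hload := (differentiable_loadChar ξ).comp (differentiable_lamPowFour a b)
  exact (differentiable_id.div_const (a : ℂ)).mul hload

/-- The sets `Z x`, `x ∈ S`, consist of the values at `x` of finitely many functions which are
continuous on `S`. Different functions may have common values. -/
def HasFiniteBranches {X E : Type*} [TopologicalSpace X] [TopologicalSpace E] (Z : X → Set E)
    (S : Set X) : Prop :=
  ∃ G : Set (X → E), G.Finite ∧ (∀ γ ∈ G, ContinuousOn γ S) ∧ ∀ x ∈ S, (fun γ => γ x) '' G = Z x

section FiniteBranches

variable {X Y E F : Type*} [TopologicalSpace X] [TopologicalSpace Y] [TopologicalSpace E]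
  [TopologicalSpace F]

theorem HasFiniteBranches.mono {Z : X → Set E} {S T : Set X} (h : HasFiniteBranches Z T)
    (hST : S ⊆ T) : HasFiniteBranches Z S := by
  obtain ⟨G, hfin, hcont, hG⟩ := h
  exact ⟨G, hfin, fun γ hγ => (hcont γ hγ).mono hST, fun x hx => hG x (hST hx)⟩

theorem HasFiniteBranches.congr {Z Z' : X → Set E} {S : Set X} (h : HasFiniteBranches Z S)
    (hZ : EqOn Z Z' S) : HasFiniteBranches Z' S := by
  obtain ⟨G, hfin, hcont, hG⟩ := h
  exact ⟨G, hfin, hcont, fun x hx => (hG x hx).trans (hZ hx)⟩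

theorem HasFiniteBranches.comp {Z : Y → Set E} {T : Set Y} (h : HasFiniteBranches Z T)
    {ψ : X → Y} {S : Set X} (hψ : ContinuousOn ψ S) (hST : MapsTo ψ S T) :
    HasFiniteBranches (Z ∘ ψ) S := by
  obtain ⟨G, hfin, hcont, hG⟩ := h
  refine ⟨(· ∘ ψ) '' G, hfin.image _, ?_, fun x hx => ?_⟩
  · rintro _ ⟨γ, hγ, rfl⟩
    exact (hcont γ hγ).comp hψ hST
  · rw [image_image, Function.comp_apply, ← hG _ (hST hx)]
    rfl

theorem HasFiniteBranches.image {Z : X → Set E} {S : Set X} (h : HasFiniteBranches Z S)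
    {ψ : E → F} {D : Set E} (hψ : ContinuousOn ψ D) (hD : ∀ x ∈ S, Z x ⊆ D) :
    HasFiniteBranches (fun x => ψ '' Z x) S := by
  obtain ⟨G, hfin, hcont, hG⟩ := h
  refine ⟨(ψ ∘ ·) '' G, hfin.image _, ?_, fun x hx => ?_⟩
  · rintro _ ⟨γ, hγ, rfl⟩
    exact hψ.comp (hcont γ hγ) fun x hx => hD x hx (hG x hx ▸ mem_image_of_mem _ hγ)
  · change _ = ψ '' Z x
    rw [← hG x hx, image_image, image_image]
    rfl

theorem HasFiniteBranches.biUnion {ι : Type*} {t : Finset ι} {Z : ι → X → Set E} {S : Set X}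
    (h : ∀ i ∈ t, HasFiniteBranches (Z i) S) :
    HasFiniteBranches (fun x => ⋃ i ∈ t, Z i x) S := by
  choose! G hfin hcont hG using h
  refine ⟨⋃ i ∈ t, G i, t.finite_toSet.biUnion hfin, fun γ hγ => ?_, fun x hx => ?_⟩
  · obtain ⟨i, hi, hγi⟩ := mem_iUnion₂.1 hγ
    exact hcont i hi γ hγi
  · rw [image_iUnion₂]
    exact iUnion₂_congr fun i hi => hG i hi x hx

theorem HasFiniteBranches.union_Icc {L : Type*} [LinearOrder L] [TopologicalSpace L]
    [OrderClosedTopology L] {Z : L → Set E} {s t u : L} (hst : s ≤ t) (htu : t ≤ u)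
    (h : HasFiniteBranches Z (Icc s t)) (h' : HasFiniteBranches Z (Icc t u)) :
    HasFiniteBranches Z (Icc s u) := by
  obtain ⟨G, hfin, hcont, hG⟩ := h
  obtain ⟨G', hfin', hcont', hG'⟩ := h'
  have hGt : (fun γ => γ t) '' G = (fun γ => γ t) '' G' :=
    (hG t (right_mem_Icc.2 hst)).trans (hG' t (left_mem_Icc.2 htu)).symm
  let glue : (L → E) → (L → E) → L → E := fun γ η x => if x ≤ t then γ x else η x
  refine ⟨{ζ | ∃ γ ∈ G, ∃ η ∈ G', γ t = η t ∧ glue γ η = ζ}, ?_, ?_, fun x hx => ?_⟩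
  · refine (hfin.image2 glue hfin').subset ?_
    rintro _ ⟨γ, hγ, η, hη, -, rfl⟩
    exact mem_image2_of_mem hγ hη
  · rintro _ ⟨γ, hγ, η, hη, hγη, rfl⟩
    rw [← Icc_union_Icc_eq_Icc hst htu]
    refine ContinuousOn.union_of_isClosed ((hcont γ hγ).congr fun x hx => if_pos hx.2)
      ((hcont' η hη).congr fun x hx => ?_) isClosed_Icc isClosed_Icc
    rcases hx.1.eq_or_lt with rfl | hlt
    · exact (if_pos le_rfl).trans hγη
    · exact if_neg hlt.not_ge
  · rcases le_or_gt x t with hxt | htx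
    · rw [← hG x ⟨hx.1, hxt⟩]
      ext z
      constructor
      · rintro ⟨_, ⟨γ, hγ, η, -, -, rfl⟩, rfl⟩
        exact ⟨γ, hγ, (if_pos hxt).symm⟩
      · rintro ⟨γ, hγ, rfl⟩
        obtain ⟨η, hη, hηγ⟩ := hGt ▸ mem_image_of_mem (fun γ : L → E => γ t) hγ
        exact ⟨_, ⟨γ, hγ, η, hη, hηγ.symm, rfl⟩, if_pos hxt⟩
    · rw [← hG' x ⟨htx.le, hx.2⟩]
      ext z
      constructor
      · rintro ⟨_, ⟨γ, -, η, hη, -, rfl⟩, rfl⟩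
        exact ⟨η, hη, (if_neg htx.not_ge).symm⟩
      · rintro ⟨η, hη, rfl⟩
        obtain ⟨γ, hγ, hγη⟩ := hGt.symm ▸ mem_image_of_mem (fun γ : L → E => γ t) hη
        exact ⟨_, ⟨γ, hγ, η, hη, hγη, rfl⟩, if_neg htx.not_ge⟩

theorem hasFiniteBranches_Icc_of_forall_mem_nhds {Z : ℝ → Set E} {s t : ℝ} (hst : s ≤ t)
    (h : ∀ x ∈ Icc s t, ∃ N ∈ 𝓝 x, HasFiniteBranches Z N) : HasFiniteBranches Z (Icc s t) := by
  choose! N hN hbranch using h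
  obtain ⟨τ, hτ0, hτmono, ⟨m, hm⟩, hτN⟩ := exists_monotone_Icc_subset_open_cover_Icc hst
    (c := fun x : Icc s t => (Subtype.val ⁻¹' interior (N x) : Set (Icc s t)))
    (fun x => isOpen_interior.preimage continuous_subtype_val)
    (fun x _ => mem_iUnion.2 ⟨x, mem_interior_iff_mem_nhds.2 (hN x x.2)⟩)
  have hstep : ∀ n, HasFiniteBranches Z (Icc (τ n : ℝ) (τ (n + 1))) := by
    intro n
    obtain ⟨x, hx⟩ := hτN n
    refine (hbranch x x.2).mono fun y hy => interior_subset ?_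
    exact hx (a := ⟨y, (τ n).2.1.trans hy.1, hy.2.trans (τ (n + 1)).2.2⟩) hy
  have hinitial : ∀ n, HasFiniteBranches Z (Icc s (τ (n + 1) : ℝ)) := by
    intro n
    induction n with
    | zero => simpa only [hτ0] using hstep 0
    | succ n ih => exact ih.union_Icc (τ (n + 1)).2.1 (hτmono (Nat.le_succ _)) (hstep (n + 1))
  simpa only [hm (m + 1) (Nat.le_succ m)] using hinitial m

theorem exists_mem_nhds_hasFiniteBranches_of_isCompact [T1Space Y] {Φ : X → E → Y}
    (hΦ : Continuous Φ.uncurry) {y : Y} {x₀ : X} {Ω K : Set E} (hK : IsCompact K) (hΩK : Ω ⊆ K)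
    (hlocal : ∀ z ∈ K, Φ x₀ z = y → ∃ U, IsOpen U ∧ z ∈ U ∧ U ⊆ Ω ∧
      ∃ N ∈ 𝓝 x₀, HasFiniteBranches (fun x => {z ∈ U | Φ x z = y}) N) :
    ∃ N ∈ 𝓝 x₀, HasFiniteBranches (fun x => {z ∈ Ω | Φ x z = y}) N := by
  let Z := K ∩ {z | Φ x₀ z = y}
  have hZ : IsCompact Z := hK.inter_right
    (isClosed_singleton.preimage (hΦ.comp (Continuous.prodMk_right x₀)))
  choose! U hUopen hzU hUΩ N hN hbranch using fun z (hz : z ∈ Z) => hlocal z hz.1 hz.2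
  obtain ⟨t, htZ, hcover⟩ :=
    hZ.elim_nhds_subcover U fun z hz => (hUopen z hz).mem_nhds (hzU z hz)
  have hopen : IsOpen (⋃ z ∈ t, U z) := isOpen_biUnion fun z hz => hUopen z (htZ z hz)
  have hoff : ∀ᶠ x in 𝓝 x₀, ∀ z ∈ K \ ⋃ z ∈ t, U z, Φ x z ≠ y :=
    (hK.diff hopen).eventually_forall_of_forall_eventually fun z hz =>
      hΦ.continuousAt.eventually_ne fun hzero => hz.2 (hcover ⟨hz.1, hzero⟩)
  refine ⟨_, inter_mem hoff ((Filter.biInter_finset_mem t).2 fun z hz => hN z (htZ z hz)), ?_⟩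
  refine (HasFiniteBranches.biUnion fun z hz => (hbranch z (htZ z hz)).mono fun x hx =>
    mem_iInter₂.1 hx.2 z hz).congr fun x hx => ?_
  ext z
  simp only [mem_iUnion, mem_ofPred_eq, exists_prop, ← and_assoc]
  constructor
  · rintro ⟨i, ⟨hi, hzi⟩, hzero⟩
    exact ⟨hUΩ i (htZ i hi) hzi, hzero⟩
  · rintro ⟨hzΩ, hzero⟩
    by_contra hnot
    refine hx.1 z ⟨hΩK hzΩ, fun hzt => hnot ?_⟩ hzero
    obtain ⟨i, hi, hzi⟩ := mem_iUnion₂.1 hzt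
    exact ⟨i, ⟨hi, hzi⟩, hzero⟩

end FiniteBranches

theorem exists_analyticAt_pow_eq {g : ℂ → ℂ} {z₀ : ℂ} (hg : AnalyticAt ℂ g z₀) (hg0 : g z₀ ≠ 0)
    {k : ℕ} (hk : k ≠ 0) : ∃ q : ℂ → ℂ, AnalyticAt ℂ q z₀ ∧ q z₀ ≠ 0 ∧ ∀ z, q z ^ k = g z := by
  refine ⟨fun z => g z₀ ^ (k : ℂ)⁻¹ * (g z / g z₀) ^ (k : ℂ)⁻¹, ?_, ?_, fun z => ?_⟩
  · refine analyticAt_const.mul ((hg.div analyticAt_const hg0).cpow analyticAt_const ?_)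
    rw [Pi.div_apply, div_self hg0]
    exact Complex.one_mem_slitPlane
  · simp only [div_self hg0, Complex.one_cpow, mul_one]
    exact fun h => hg0 (by rw [← Complex.cpow_nat_inv_pow (g z₀) hk, h, zero_pow hk])
  · rw [mul_pow, Complex.cpow_nat_inv_pow _ hk, Complex.cpow_nat_inv_pow _ hk,
      mul_div_cancel₀ _ hg0]

theorem exists_eventually_eq_pow {h : ℂ → ℂ} {z₀ : ℂ} (hh : AnalyticAt ℂ h z₀) (h0 : h z₀ = 0)
    (hne : ¬ ∀ᶠ z in 𝓝 z₀, h z = 0) :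
    ∃ k : ℕ, k ≠ 0 ∧ ∃ ψ : ℂ → ℂ, AnalyticAt ℂ ψ z₀ ∧ deriv ψ z₀ ≠ 0 ∧ ψ z₀ = 0 ∧
      ∀ᶠ z in 𝓝 z₀, h z = ψ z ^ k := by
  obtain ⟨k, g, hg, hg0, hgh⟩ := hh.exists_eventuallyEq_pow_smul_nonzero_iff.2 hne
  have hk : k ≠ 0 := by
    rintro rfl
    exact hg0 (by simpa only [h0, pow_zero, one_smul] using hgh.self_of_nhds.symm)
  obtain ⟨q, hq, hq0, hqg⟩ := exists_analyticAt_pow_eq hg hg0 hk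
  have hderiv : HasDerivAt (fun z => (z - z₀) * q z) (q z₀) z₀ :=
    (((hasDerivAt_id z₀).sub_const z₀).mul hq.differentiableAt.hasDerivAt).congr_deriv (by simp)
  refine ⟨k, hk, fun z => (z - z₀) * q z, (analyticAt_id.sub analyticAt_const).mul hq,
    hderiv.deriv.trans_ne hq0, by simp only [sub_self, zero_mul], ?_⟩
  filter_upwards [hgh] with z hz
  rw [hz, mul_pow, hqg, smul_eq_mul]

theorem exists_continuous_pow_eq_ofReal {k : ℕ} (hk : k ≠ 0) :
    ∃ ρ : ℝ → ℂ, Continuous ρ ∧ ∀ s, ρ s ^ k = s := by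
  obtain ⟨ω, hω⟩ : ∃ ω : ℂ, ω ^ k = -1 := ⟨_, Complex.cpow_nat_inv_pow _ hk⟩
  have hk' : (0 : ℝ) < (k : ℝ)⁻¹ := inv_pos.2 (Nat.cast_pos.2 (Nat.pos_of_ne_zero hk))
  refine ⟨fun s => (max s 0 ^ (k : ℝ)⁻¹ : ℝ) + ω * (max (-s) 0 ^ (k : ℝ)⁻¹ : ℝ), ?_, fun s => ?_⟩
  · have hpos : Continuous fun s : ℝ => max s 0 ^ (k : ℝ)⁻¹ :=
      (continuous_id.max continuous_const).rpow_const fun _ => Or.inr hk'.le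
    exact (Complex.continuous_ofReal.comp hpos).add
      (continuous_const.mul (Complex.continuous_ofReal.comp (hpos.comp continuous_neg)))
  · rcases le_total 0 s with hs | hs
    · simp only [max_eq_left hs, max_eq_right (neg_nonpos.2 hs), Real.zero_rpow hk'.ne',
        Complex.ofReal_zero, mul_zero, add_zero]
      rw [← Complex.ofReal_pow, Real.rpow_inv_natCast_pow hs hk]
    · simp only [max_eq_right hs, max_eq_left (neg_nonneg.2 hs), Real.zero_rpow hk'.ne',
        Complex.ofReal_zero, zero_add, mul_pow, hω]
      rw [← Complex.ofReal_pow, Real.rpow_inv_natCast_pow (neg_nonneg.2 hs) hk,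
        Complex.ofReal_neg, neg_one_mul, neg_neg]

theorem hasFiniteBranches_pow_eq_ofReal {k : ℕ} (hk : k ≠ 0) :
    HasFiniteBranches (fun s : ℝ => {ζ : ℂ | ζ ^ k = s}) univ := by
  obtain ⟨ρ, hρ, hρk⟩ := exists_continuous_pow_eq_ofReal hk
  refine ⟨(fun ω s => ω * ρ s) '' {ω : ℂ | ω ^ k = 1}, Finite.image _ ?_, ?_, fun s _ => ?_⟩
  · exact (Polynomial.nthRoots k (1 : ℂ)).finite_toSet.subset fun ω hω =>
      (Polynomial.mem_nthRoots (Nat.pos_of_ne_zero hk)).2 hω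
  · rintro _ ⟨ω, -, rfl⟩
    exact (continuous_const.mul hρ).continuousOn
  · rw [image_image]
    ext ζ
    constructor
    · rintro ⟨ω, hω, rfl⟩
      exact (mul_pow ω _ k).trans (by rw [show ω ^ k = 1 from hω, hρk, one_mul])
    · intro hζ
      have hζρ : ζ ^ k = ρ s ^ k := (show ζ ^ k = s from hζ).trans (hρk s).symm
      rcases eq_or_ne (ρ s) 0 with hs | hs
      · refine ⟨1, one_pow k, ?_⟩
        rw [hs, zero_pow hk] at hζρ
        rw [pow_eq_zero_iff hk |>.1 hζρ]
        exact (one_mul _).trans hs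
      · refine ⟨ζ / ρ s, ?_, div_mul_cancel₀ _ hs⟩
        exact (div_pow _ _ k).trans (by rw [hζρ, div_self (pow_ne_zero k hs)])

theorem exists_openPartialHomeomorph_of_deriv_ne_zero {ψ : ℂ → ℂ} {z₀ : ℂ}
    (hψ : AnalyticAt ℂ ψ z₀) (hψ' : deriv ψ z₀ ≠ 0) {O : Set ℂ} (hO : O ∈ 𝓝 z₀) :
    ∃ R : OpenPartialHomeomorph ℂ ℂ, z₀ ∈ R.source ∧ R.source ⊆ O ∧ ∀ z, R z = ψ z := by
  have hstrict := hψ.hasStrictDerivAt.hasStrictFDerivAt_equiv hψ'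
  exact ⟨(hstrict.toOpenPartialHomeomorph ψ).restrOpen (interior O) isOpen_interior,
    ⟨hstrict.mem_toOpenPartialHomeomorph_source, mem_interior_iff_mem_nhds.2 hO⟩,
    fun z hz => interior_subset hz.2, fun z => rfl⟩

theorem exists_hasFiniteBranches_pow_comp {k : ℕ} (hk : k ≠ 0) (R : OpenPartialHomeomorph ℂ ℂ)
    (hR : 0 ∈ R.target) :
    ∃ N ∈ 𝓝 (0 : ℝ), HasFiniteBranches (fun s : ℝ => {z ∈ R.source | R z ^ k = s}) N := by
  obtain ⟨ε, hε, hball⟩ := Metric.isOpen_iff.1 R.open_target 0 hR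
  have htarget : ∀ s ∈ Metric.ball (0 : ℝ) (ε ^ k), {ζ : ℂ | ζ ^ k = s} ⊆ R.target := by
    refine fun s hs ζ hζ => hball (mem_ball_zero_iff.2 (lt_of_pow_lt_pow_left₀ k hε.le ?_))
    rw [← norm_pow, show ζ ^ k = s from hζ, Complex.norm_real]
    exact mem_ball_zero_iff.1 hs
  refine ⟨Metric.ball 0 (ε ^ k), Metric.ball_mem_nhds _ (by positivity), ?_⟩
  refine (((hasFiniteBranches_pow_eq_ofReal hk).mono (subset_univ _)).image
    R.continuousOn_symm htarget).congr fun s hs => ?_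
  exact R.symm_image_eq_source_inter_preimage (htarget s hs)

theorem exists_local_branches_eq_ofReal {h : ℂ → ℂ} {z₀ : ℂ} {s₀ : ℝ} (hh : AnalyticAt ℂ h z₀)
    (h0 : h z₀ = s₀) (hne : ¬ ∀ᶠ z in 𝓝 z₀, h z = s₀) {O : Set ℂ} (hO : O ∈ 𝓝 z₀) :
    ∃ U, IsOpen U ∧ z₀ ∈ U ∧ U ⊆ O ∧
      ∃ N ∈ 𝓝 s₀, HasFiniteBranches (fun s : ℝ => {z ∈ U | h z = s}) N := by
  obtain ⟨k, hk, ψ, hψ, hψ', hψ0, hpow⟩ := exists_eventually_eq_pow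
    (hh.sub analyticAt_const) (sub_eq_zero.2 h0) (by simpa only [Pi.sub_apply, sub_eq_zero])
  obtain ⟨R, hz₀, hRO, hRψ⟩ :=
    exists_openPartialHomeomorph_of_deriv_ne_zero hψ hψ' (inter_mem hO hpow)
  have hR0 : (0 : ℂ) ∈ R.target := by
    rw [← hψ0, ← hRψ]
    exact R.map_source hz₀
  obtain ⟨N, hN, hbranch⟩ := exists_hasFiniteBranches_pow_comp hk R hR0
  have hshift : Tendsto (fun s => s - s₀) (𝓝 s₀) (𝓝 0) := by
    simpa only [sub_self] using (continuous_sub_right s₀).tendsto s₀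
  refine ⟨R.source, R.open_source, hz₀, fun z hz => (hRO hz).1, _, hshift hN,
    (hbranch.comp (continuous_sub_right s₀).continuousOn fun s hs => hs).congr fun s _ => ?_⟩
  ext z
  refine and_congr_right fun hz => ?_
  have hz' : h z - s₀ = R z ^ k := by rw [hRψ]; exact (hRO hz).2
  rw [← hz', Complex.ofReal_sub, sub_left_inj]

theorem not_eventually_add_const_mul_eq_zero {f g : ℂ → ℂ} (hf : Differentiable ℂ f)
    (hg : Differentiable ℂ g) {c w : ℂ} (hw : f w + c * g w ≠ 0) (z : ℂ) :
    ¬ ∀ᶠ y in 𝓝 z, f y + c * g y = 0 := by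
  intro hzero
  have hdiff : Differentiable ℂ fun y => f y + c * g y := hf.add (hg.const_mul c)
  exact hw (congrFun (AnalyticOnNhd.eq_of_eventuallyEq (g := 0) (fun y _ => hdiff.analyticAt y)
    (fun y _ => analyticAt_const) hzero) w)

theorem exists_local_branches_add_mul {f g : ℂ → ℂ} (hf : Differentiable ℂ f)
    (hg : Differentiable ℂ g) {α₀ : ℝ} {w z₀ : ℂ} (hw : f w + α₀ * g w ≠ 0)
    (h0 : f z₀ + α₀ * g z₀ = 0) (hg0 : g z₀ ≠ 0) {O : Set ℂ} (hO : O ∈ 𝓝 z₀) :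
    ∃ U, IsOpen U ∧ z₀ ∈ U ∧ U ⊆ O ∧
      ∃ N ∈ 𝓝 α₀, HasFiniteBranches (fun α : ℝ => {z ∈ U | f z + α * g z = 0}) N := by
  have hquot : ∀ {z}, g z ≠ 0 → ∀ α : ℝ, (-f z / g z = α ↔ f z + α * g z = 0) := fun hz α => by
    rw [div_eq_iff hz, neg_eq_iff_add_eq_zero]
  have hgne : ∀ᶠ z in 𝓝 z₀, g z ≠ 0 := hg.continuous.continuousAt.eventually_ne hg0
  obtain ⟨U, hU, hz₀, hUO, N, hN, hbranch⟩ := exists_local_branches_eq_ofReal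
    ((hf.analyticAt z₀).neg.div (hg.analyticAt z₀) hg0) ((hquot hg0 α₀).2 h0)
    (fun hconst => not_eventually_add_const_mul_eq_zero hf hg hw z₀
      ((hconst.and hgne).mono fun z hz => (hquot hz.2 α₀).1 hz.1)) (inter_mem hO hgne)
  refine ⟨U, hU, hz₀, fun z hz => (hUO hz).1, N, hN, hbranch.congr fun α _ => ?_⟩
  ext z
  exact and_congr_right fun hz => hquot (hUO hz).2 α

theorem hasFiniteBranches_zeros_add_mul {f g : ℂ → ℂ} (hf : Differentiable ℂ f)
    (hg : Differentiable ℂ g) (hfg : ∀ z, f z = 0 → g z ≠ 0) {Ω K : Set ℂ} (hΩ : IsOpen Ω)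
    (hK : IsCompact K) (hΩK : Ω ⊆ K) {s t : ℝ} (hst : s ≤ t)
    (hne : ∀ α ∈ Icc s t, ∃ w, f w + α * g w ≠ 0)
    (hKΩ : ∀ α ∈ Icc s t, ∀ z ∈ K, f z + α * g z = 0 → z ∈ Ω) :
    HasFiniteBranches (fun α : ℝ => {z ∈ Ω | f z + α * g z = 0}) (Icc s t) := by
  refine hasFiniteBranches_Icc_of_forall_mem_nhds hst fun α hα => ?_
  have hcont : Continuous fun p : ℝ × ℂ => f p.2 + p.1 * g p.2 :=
    (hf.continuous.comp continuous_snd).add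
      ((Complex.continuous_ofReal.comp continuous_fst).mul (hg.continuous.comp continuous_snd))
  obtain ⟨w, hw⟩ := hne α hα
  refine exists_mem_nhds_hasFiniteBranches_of_isCompact hcont hK hΩK fun z hz hzero =>
    exists_local_branches_add_mul hf hg hw hzero (fun hgz => hfg z ?_ hgz)
      (hΩ.mem_nhds (hKΩ α hα z hz hzero))
  rwa [hgz, mul_zero, add_zero] at hzero

theorem norm_sin_sq (z : ℂ) :
    ‖Complex.sin z‖ ^ 2 = Real.sin z.re ^ 2 + Real.sinh z.im ^ 2 := by
  rw [Complex.sq_norm, Complex.sin_eq, ← Complex.ofReal_sin, ← Complex.ofReal_cosh,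
    ← Complex.ofReal_cos, ← Complex.ofReal_sinh, ← Complex.ofReal_mul, ← Complex.ofReal_mul,
    Complex.normSq_add_mul_I]
  linear_combination Real.sin z.re ^ 2 * Real.cosh_sq z.im +
    Real.sinh z.im ^ 2 * Real.sin_sq_add_cos_sq z.re

theorem norm_sin_mul_I (z : ℂ) : ‖Complex.sin (z * Complex.I)‖ = ‖Complex.sinh z‖ := by
  rw [Complex.sin_mul_I, norm_mul, Complex.norm_I, mul_one]

theorem norm_sin_le_exp_abs_im (z : ℂ) : ‖Complex.sin z‖ ≤ Real.exp |z.im| := by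
  have hsin : ‖Complex.sin z‖ ≤ Real.cosh z.im := by
    refine abs_le_of_sq_le_sq' ?_ (Real.cosh_pos _).le |>.2
    rw [norm_sin_sq, Real.cosh_sq, add_comm]
    gcongr
    exact Real.sin_sq_le_one _
  calc ‖Complex.sin z‖ ≤ Real.cosh |z.im| := by rwa [Real.cosh_abs]
    _ ≤ Real.exp |z.im| := by
      have hsinh : 0 ≤ Real.sinh |z.im| := Real.sinh_nonneg_iff.2 (abs_nonneg _)
      linarith [Real.cosh_add_sinh |z.im|]

theorem norm_sinh_le_exp_abs_re (z : ℂ) : ‖Complex.sinh z‖ ≤ Real.exp |z.re| := by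
  simpa only [norm_sin_mul_I, Complex.mul_I_im] using norm_sin_le_exp_abs_im (z * Complex.I)

theorem sinh_abs_im_le_norm_sin (z : ℂ) : Real.sinh |z.im| ≤ ‖Complex.sin z‖ := by
  refine abs_le_of_sq_le_sq' ?_ (norm_nonneg _) |>.2
  rw [norm_sin_sq, ← Real.abs_sinh, sq_abs]
  exact le_add_of_nonneg_left (sq_nonneg _)

theorem abs_sin_re_le_norm_sin (z : ℂ) : |Real.sin z.re| ≤ ‖Complex.sin z‖ := by
  refine abs_le_of_sq_le_sq ?_ (norm_nonneg _)
  rw [norm_sin_sq]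
  exact le_add_of_nonneg_right (sq_nonneg _)

/-- The radii of the circles in the plane of the frequencies which separate the frequencies `n π`
of the free beam. -/
def radius (n : ℕ) : ℝ := (n + 1 / 2) * Real.pi

theorem natCast_add_one_le_radius (n : ℕ) : (n : ℝ) + 1 ≤ radius n := by
  unfold radius
  nlinarith [Real.pi_gt_three, n.cast_nonneg (α := ℝ)]

theorem radius_pos (n : ℕ) : 0 < radius n := by
  linarith [natCast_add_one_le_radius n, n.cast_nonneg (α := ℝ)]

theorem abs_sin_radius_sub (n : ℕ) (x : ℝ) : |Real.sin (radius n - x)| = |Real.cos x| := by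
  rw [show radius n - x = Real.pi / 2 - x + n * Real.pi by unfold radius; ring,
    Real.sin_add_nat_mul_pi, Real.sin_pi_div_two_sub, abs_mul, abs_neg_one_pow, one_mul]

theorem half_le_abs_sin_re {n : ℕ} {z : ℂ} (hz : ‖z‖ = radius n) (him : |z.im| ≤ 1) :
    1 / 2 ≤ |Real.sin z.re| := by
  have hradius : 3 / 2 ≤ radius n := by
    unfold radius
    nlinarith [Real.pi_gt_three, n.cast_nonneg (α := ℝ)]
  have hsq : radius n ^ 2 = |z.re| ^ 2 + |z.im| ^ 2 := by
    rw [← hz, Complex.sq_norm, Complex.normSq_apply, sq_abs, sq_abs]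
    ring
  have hgap0 : 0 ≤ radius n - |z.re| := sub_nonneg.2 (hz ▸ Complex.abs_re_le_norm z)
  have hgap : radius n - |z.re| ≤ 1 / 2 := by
    nlinarith [abs_nonneg z.re, abs_nonneg z.im]
  have hsin : |Real.sin z.re| = |Real.cos (radius n - |z.re|)| := by
    rw [← abs_sin_radius_sub n, sub_sub_cancel]
    rcases abs_choice z.re with h | h <;> rw [h]
    rw [Real.sin_neg, abs_neg]
  calc (1 : ℝ) / 2 ≤ 1 - (radius n - |z.re|) ^ 2 / 2 := by nlinarith
    _ ≤ Real.cos (radius n - |z.re|) := Real.one_sub_sq_div_two_le_cos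
    _ ≤ |Real.sin z.re| := hsin ▸ le_abs_self _

theorem exp_abs_im_le_norm_sin {n : ℕ} {z : ℂ} (hz : ‖z‖ = radius n) :
    Real.exp |z.im| / 8 ≤ ‖Complex.sin z‖ := by
  rcases le_total 1 |z.im| with him | him
  · have hexp := Real.add_one_le_exp |z.im|
    have hexp_neg : Real.exp (-|z.im|) ≤ 1 := Real.exp_le_one_iff.2 (by linarith)
    linarith [sinh_abs_im_le_norm_sin z, Real.sinh_eq |z.im|]
  · have hexp : Real.exp |z.im| ≤ 3 := (Real.exp_le_exp.2 him).trans Real.exp_one_lt_three.le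
    linarith [half_le_abs_sin_re hz him, abs_sin_re_le_norm_sin z]

theorem exp_abs_re_le_norm_sinh {n : ℕ} {z : ℂ} (hz : ‖z‖ = radius n) :
    Real.exp |z.re| / 8 ≤ ‖Complex.sinh z‖ := by
  have hsin := exp_abs_im_le_norm_sin (z := z * Complex.I) (n := n)
    (by rwa [norm_mul, Complex.norm_I, mul_one])
  rwa [norm_sin_mul_I, Complex.mul_I_im] at hsin

theorem norm_sin_mul_norm_sin_le (z : ℂ) {s t : ℝ} (hs : 0 ≤ s) (ht : 0 ≤ t) :
    ‖Complex.sin (z * s)‖ * ‖Complex.sin (z * t)‖ ≤ Real.exp (|z.im| * (s + t)) := by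
  have hsin : ∀ {r : ℝ}, 0 ≤ r → ‖Complex.sin (z * r)‖ ≤ Real.exp (|z.im| * r) := fun {r} hr => by
    simpa only [Complex.im_mul_ofReal, abs_mul, abs_of_nonneg hr] using
      norm_sin_le_exp_abs_im (z * r)
  rw [mul_add, Real.exp_add]
  exact mul_le_mul (hsin hs) (hsin ht) (norm_nonneg _) (Real.exp_pos _).le

theorem norm_sinh_mul_norm_sinh_le (z : ℂ) {s t : ℝ} (hs : 0 ≤ s) (ht : 0 ≤ t) :
    ‖Complex.sinh (z * s)‖ * ‖Complex.sinh (z * t)‖ ≤ Real.exp (|z.re| * (s + t)) := by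
  have hsin := norm_sin_mul_norm_sin_le (z * Complex.I) hs ht
  rwa [mul_right_comm, norm_sin_mul_I, mul_right_comm, norm_sin_mul_I, Complex.mul_I_im] at hsin

theorem norm_pow_five_mul_loadChar_le {ξ : ℝ} (hξ : ξ ∈ Icc (0 : ℝ) 1) (l : ℂ) :
    ‖2 * l ^ 5 * loadChar ξ (l ^ 4)‖ ≤ 2 * (Real.exp |l.re| * Real.exp |l.im|) := by
  have hsin := norm_sin_mul_norm_sin_le l (sub_nonneg.2 hξ.2) hξ.1
  have hsinh := norm_sinh_mul_norm_sinh_le l (sub_nonneg.2 hξ.2) hξ.1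
  rw [sub_add_cancel, mul_one, Complex.ofReal_sub, Complex.ofReal_one] at hsin hsinh
  rw [pow_five_mul_loadChar, two_mul]
  refine (norm_sub_le _ _).trans (add_le_add ?_ ?_)
  · rw [norm_mul, norm_mul, mul_comm]
    exact mul_le_mul (norm_sinh_le_exp_abs_re l) hsin (by positivity) (Real.exp_pos _).le
  · rw [norm_mul, norm_mul]
    exact mul_le_mul hsinh (norm_sin_le_exp_abs_im l) (norm_nonneg _) (Real.exp_pos _).le

theorem le_norm_sq_mul_freeChar {n : ℕ} {l : ℂ} (hl : ‖l‖ = radius n) :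
    Real.exp |l.re| * Real.exp |l.im| / 64 ≤ ‖l ^ 2 * freeChar (l ^ 4)‖ := by
  rw [sq_mul_freeChar, norm_mul]
  calc Real.exp |l.re| * Real.exp |l.im| / 64 = Real.exp |l.im| / 8 * (Real.exp |l.re| / 8) := by
        ring
    _ ≤ ‖Complex.sin l‖ * ‖Complex.sinh l‖ :=
      mul_le_mul (exp_abs_im_le_norm_sin hl) (exp_abs_re_le_norm_sinh hl) (by positivity)
        (norm_nonneg _)

theorem exists_pow_four_eq (w : ℂ) : ∃ l : ℂ, l ^ 4 = w :=
  ⟨w ^ ((4 : ℕ) : ℂ)⁻¹, Complex.cpow_nat_inv_pow w four_ne_zero⟩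

theorem freeChar_add_mul_loadChar_ne_zero {ξ : ℝ} (hξ : ξ ∈ Icc (0 : ℝ) 1) {n : ℕ} {w κ : ℂ}
    (hw : ‖w‖ = radius n ^ 4) (hκ : 64 * ‖κ‖ < radius n ^ 3) :
    freeChar w + κ * loadChar ξ w ≠ 0 := by
  intro hzero
  obtain ⟨l, rfl⟩ := exists_pow_four_eq w
  have hl : ‖l‖ = radius n := by
    rw [norm_pow] at hw
    exact (pow_left_inj₀ (norm_nonneg _) (radius_pos n).le four_ne_zero).1 hw
  have hbalance : 2 * l ^ 3 * (l ^ 2 * freeChar (l ^ 4)) =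
      -(κ * (2 * l ^ 5 * loadChar ξ (l ^ 4))) := by
    linear_combination 2 * l ^ 5 * hzero
  have hE : 0 < Real.exp |l.re| * Real.exp |l.im| := by positivity
  have hle : 2 * radius n ^ 3 * (Real.exp |l.re| * Real.exp |l.im| / 64) ≤
      ‖κ‖ * (2 * (Real.exp |l.re| * Real.exp |l.im|)) :=
    calc 2 * radius n ^ 3 * (Real.exp |l.re| * Real.exp |l.im| / 64)
        ≤ 2 * ‖l‖ ^ 3 * ‖l ^ 2 * freeChar (l ^ 4)‖ := by
          rw [hl]
          exact mul_le_mul_of_nonneg_left (le_norm_sq_mul_freeChar hl)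
            (by have := radius_pos n; positivity)
      _ = ‖κ‖ * ‖2 * l ^ 5 * loadChar ξ (l ^ 4)‖ := by
          simpa only [norm_mul, norm_neg, norm_pow, Complex.norm_ofNat] using congrArg norm hbalance
      _ ≤ ‖κ‖ * (2 * (Real.exp |l.re| * Real.exp |l.im|)) := by
          gcongr
          exact norm_pow_five_mul_loadChar_le hξ l
  nlinarith

theorem exists_nat_pow_four_eq_of_sin_mul_sinh_eq_zero {l : ℂ}
    (h : Complex.sin l * Complex.sinh l = 0) : ∃ n : ℕ, l ^ 4 = ((n : ℂ) * Real.pi) ^ 4 := by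
  obtain ⟨k, hk⟩ : ∃ k : ℤ, l ^ 4 = (k * Real.pi) ^ 4 := by
    rcases mul_eq_zero.1 h with hsin | hsinh
    · obtain ⟨k, rfl⟩ := Complex.sin_eq_zero_iff.1 hsin
      exact ⟨k, rfl⟩
    · have hsin : Complex.sin (l * Complex.I) = 0 := by
        rw [Complex.sin_mul_I, hsinh, zero_mul]
      obtain ⟨k, hk⟩ := Complex.sin_eq_zero_iff.1 hsin
      exact ⟨k, by rw [← hk, mul_pow, Complex.I_pow_four, mul_one]⟩
  refine ⟨k.natAbs, hk.trans ?_⟩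
  rw [mul_pow, mul_pow, Nat.cast_natAbs, ← Int.cast_pow, ← Int.cast_pow,
    Even.pow_abs (n := 4) (by decide)]

theorem natCast_mul_pi_ne_zero {n : ℕ} (hn : 1 ≤ n) : (n : ℂ) * Real.pi ≠ 0 :=
  mul_ne_zero (Nat.cast_ne_zero.2 (Nat.one_le_iff_ne_zero.1 hn))
    (Complex.ofReal_ne_zero.2 Real.pi_ne_zero)

theorem freeChar_eq_zero_iff (w : ℂ) :
    freeChar w = 0 ↔ ∃ n : ℕ, 1 ≤ n ∧ w = ((n : ℂ) * Real.pi) ^ 4 := by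
  constructor
  · intro hw
    obtain ⟨l, rfl⟩ := exists_pow_four_eq w
    have hchar := sq_mul_freeChar l
    rw [hw, mul_zero] at hchar
    obtain ⟨n, hn⟩ := exists_nat_pow_four_eq_of_sin_mul_sinh_eq_zero hchar.symm
    refine ⟨n, Nat.one_le_iff_ne_zero.2 ?_, hn⟩
    rintro rfl
    rw [hn, Nat.cast_zero, zero_mul, zero_pow four_ne_zero, freeChar_zero] at hw
    exact one_ne_zero hw
  · rintro ⟨n, hn, rfl⟩
    have hchar := sq_mul_freeChar (n * Real.pi)
    rw [Complex.sin_nat_mul_pi, zero_mul] at hchar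
    exact (mul_eq_zero.1 hchar).resolve_left (pow_ne_zero 2 (natCast_mul_pi_ne_zero hn))

theorem sin_natCast_mul_pi_mul_ne_zero {η : ℝ} (hη : Irrational η) {n : ℕ} (hn : 1 ≤ n) :
    Complex.sin (n * Real.pi * η) ≠ 0 := by
  intro hsin
  obtain ⟨k, hk⟩ := Complex.sin_eq_zero_iff.1 hsin
  have hk' : (n : ℝ) * Real.pi * η = k * Real.pi := by exact_mod_cast hk
  refine (hη.natCast_mul (Nat.one_le_iff_ne_zero.1 hn)).ne_int k ?_
  exact mul_right_cancel₀ Real.pi_ne_zero (by rw [← hk', mul_right_comm])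

theorem sinh_natCast_mul_pi_ne_zero {n : ℕ} (hn : 1 ≤ n) : Complex.sinh (n * Real.pi) ≠ 0 := by
  have hpos : (0 : ℝ) < n * Real.pi := mul_pos (by exact_mod_cast hn) Real.pi_pos
  exact_mod_cast (Real.sinh_pos_iff.2 hpos).ne'

theorem irrational_one_sub {ξ : ℝ} (hξ : Irrational ξ) : Irrational (1 - ξ) := by
  simpa only [Rat.cast_one] using hξ.ratCast_sub 1

theorem loadChar_natCast_mul_pi_ne_zero {ξ : ℝ} (hξ : Irrational ξ) {n : ℕ} (hn : 1 ≤ n) :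
    loadChar ξ (((n : ℂ) * Real.pi) ^ 4) ≠ 0 := by
  intro hzero
  have hload := pow_five_mul_loadChar ξ (n * Real.pi)
  have hsin := sin_natCast_mul_pi_mul_ne_zero (irrational_one_sub hξ) hn
  rw [Complex.ofReal_sub, Complex.ofReal_one] at hsin
  rw [hzero, mul_zero, Complex.sin_nat_mul_pi, mul_zero, sub_zero] at hload
  exact mul_ne_zero (mul_ne_zero hsin (sin_natCast_mul_pi_mul_ne_zero hξ hn))
    (sinh_natCast_mul_pi_ne_zero hn) hload.symm

theorem lamPowFour_zero (a b : ℝ) : lamPowFour a b 0 = 0 := by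
  simp only [lamPowFour, mul_zero, ne_eq, OfNat.ofNat_ne_zero, not_false_eq_true, zero_pow,
    add_zero, neg_zero, zero_div]

theorem loadCoeff_ne_zero {a : ℝ} (ha : a ≠ 0) (b : ℝ) {ξ : ℝ} (hξ : Irrational ξ) {μ : ℂ}
    (hμ : freeChar (lamPowFour a b μ) = 0) : loadCoeff a b ξ μ ≠ 0 := by
  obtain ⟨n, hn, hw⟩ := (freeChar_eq_zero_iff _).1 hμ
  refine mul_ne_zero (div_ne_zero ?_ (Complex.ofReal_ne_zero.2 ha)) ?_
  · rintro rfl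
    rw [lamPowFour_zero, freeChar_zero] at hμ
    exact one_ne_zero hμ
  · rw [hw]
    exact loadChar_natCast_mul_pi_ne_zero hξ hn

theorem exists_muZero_eq (a b : ℝ) (n : ℕ) :
    ∃ D : ℂ, D ^ 2 = b ^ 2 - 4 * a * ((n : ℂ) * Real.pi) ^ 4 ∧
      ∀ s : ℤˣ, muZero a b n s = (1 / 2) * (-(b : ℂ) + ((s : ℤ) : ℂ) * D) := by
  unfold muZero
  split_ifs with h
  · refine ⟨_, ?_, fun s => rfl⟩
    rw [← Complex.ofReal_pow, Real.sq_sqrt (by linarith)]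
    push_cast
    ring
  · refine ⟨_, ?_, fun s => rfl⟩
    rw [mul_pow, Complex.I_sq, ← Complex.ofReal_pow, Real.sq_sqrt (by linarith)]
    push_cast
    ring

theorem lamPowFour_eq_iff {a : ℝ} (ha : a ≠ 0) (b : ℝ) (n : ℕ) (μ : ℂ) :
    lamPowFour a b μ = ((n : ℂ) * Real.pi) ^ 4 ↔ ∃ s : ℤˣ, μ = muZero a b n s := by
  obtain ⟨D, hD, hmuZero⟩ := exists_muZero_eq a b n
  have hsq : lamPowFour a b μ = ((n : ℂ) * Real.pi) ^ 4 ↔ (2 * μ + b) ^ 2 = D ^ 2 := by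
    rw [hD, lamPowFour, div_eq_iff (Complex.ofReal_ne_zero.2 ha)]
    constructor <;> intro h
    · linear_combination -4 * h
    · linear_combination -h / 4
  rw [hsq, sq_eq_sq_iff_eq_or_eq_neg]
  constructor
  · rintro (h | h)
    · exact ⟨1, by rw [hmuZero]; push_cast; linear_combination h / 2⟩
    · exact ⟨-1, by rw [hmuZero]; push_cast; linear_combination h / 2⟩
  · rintro ⟨s, rfl⟩
    rw [hmuZero]
    rcases Int.units_eq_one_or s with rfl | rfl
    · left
      push_cast
      ring
    · right
      push_cast
      ring

theorem lamPowFour_muZero {a : ℝ} (ha : a ≠ 0) (b : ℝ) (n : ℕ) (s : ℤˣ) :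
    lamPowFour a b (muZero a b n s) = ((n : ℂ) * Real.pi) ^ 4 :=
  (lamPowFour_eq_iff ha b n _).2 ⟨s, rfl⟩

theorem isEigenvalue_zero_iff {a : ℝ} (ha : a ≠ 0) (b : ℝ) (ξ : Ioo (0 : ℝ) 1) (μ : ℂ) :
    IsEigenvalue (A a b 0 ξ) μ ↔ ∃ n : ℕ, 1 ≤ n ∧ ∃ s : ℤˣ, μ = muZero a b n s := by
  rw [isEigenvalue_iff ha, Complex.ofReal_zero, zero_mul, add_zero, freeChar_eq_zero_iff]
  exact exists_congr fun n => and_congr_right fun _ => lamPowFour_eq_iff ha b n μ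

theorem injective_muZero {a : ℝ} (ha : a ≠ 0) (b : ℝ) (s : ℤˣ) :
    Function.Injective fun n => muZero a b n s := by
  intro n n' h
  have hpow : ((n : ℂ) * Real.pi) ^ 4 = ((n' : ℂ) * Real.pi) ^ 4 := by
    rw [← lamPowFour_muZero ha b n s, ← lamPowFour_muZero ha b n' s]
    exact congrArg _ h
  rw [mul_pow, mul_pow] at hpow
  have hcancel := mul_right_cancel₀
    (pow_ne_zero 4 (Complex.ofReal_ne_zero.2 Real.pi_ne_zero)) hpow
  exact Nat.pow_left_injective four_ne_zero (by exact_mod_cast hcancel)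

theorem infinite_setOf_isEigenvalue_zero {a : ℝ} (ha : a ≠ 0) (b : ℝ) (ξ : Ioo (0 : ℝ) 1) :
    {μ | IsEigenvalue (A a b 0 ξ) μ}.Infinite := by
  refine infinite_of_injective_forall_mem (f := fun n => muZero a b (n + 1) 1)
    ((injective_muZero ha b 1).comp (add_left_injective 1)) fun n => ?_
  exact (isEigenvalue_zero_iff ha b ξ _).2 ⟨n + 1, Nat.le_add_left 1 n, 1, rfl⟩

theorem norm_le_of_norm_lamPowFour_le {a : ℝ} (ha : a ≠ 0) (b : ℝ) {μ : ℂ} {R : ℝ} (hR : 0 ≤ R)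
    (h : ‖lamPowFour a b μ‖ ≤ R ^ 2) : ‖μ‖ ≤ |b| + (|a| + 1) * R := by
  by_contra! hlarge
  have hsub : ‖μ‖ - |b| ≤ ‖μ + b‖ := by
    simpa only [norm_neg, sub_neg_eq_add, Complex.norm_real, Real.norm_eq_abs] using
      norm_sub_norm_le μ (-(b : ℂ))
  have hprod : ‖μ‖ * ‖μ + b‖ ≤ |a| * R ^ 2 := by
    have hnorm : ‖(a : ℂ) * lamPowFour a b μ‖ = ‖μ‖ * ‖μ + b‖ := by
      rw [mul_lamPowFour ha, norm_neg, ← norm_mul]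
      ring_nf
    rw [← hnorm, norm_mul, Complex.norm_real, Real.norm_eq_abs]
    gcongr
  have hR' : 0 ≤ (|a| + 1) * R := by positivity
  have hmul : (|a| + 1) * R * ((|a| + 1) * R) < ‖μ‖ * ‖μ + b‖ :=
    mul_lt_mul'' (by linarith [abs_nonneg b]) (by linarith) hR' hR'
  nlinarith [abs_nonneg a, sq_nonneg R, mul_nonneg (abs_nonneg a) (sq_nonneg R),
    mul_nonneg (sq_nonneg |a|) (sq_nonneg R)]

theorem norm_lamPowFour_le (a b : ℝ) {μ : ℂ} {R : ℝ} (hμ : ‖μ‖ ≤ R) :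
    ‖lamPowFour a b μ‖ ≤ (|b| * R + R ^ 2) / |a| := by
  rw [lamPowFour, norm_div, norm_neg, Complex.norm_real, Real.norm_eq_abs]
  gcongr
  refine (norm_add_le _ _).trans ?_
  rw [norm_mul, norm_pow, Complex.norm_real, Real.norm_eq_abs]
  gcongr

theorem isCompact_setOf_norm_lamPowFour_le {a : ℝ} (ha : a ≠ 0) (b r : ℝ) :
    IsCompact {μ : ℂ | ‖lamPowFour a b μ‖ ≤ r} := by
  refine (isCompact_closedBall (0 : ℂ) (|b| + (|a| + 1) * (|r| + 1))).of_isClosed_subset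
    (isClosed_le (differentiable_lamPowFour a b).continuous.norm continuous_const) fun μ hμ => ?_
  rw [mem_closedBall_zero_iff]
  refine norm_le_of_norm_lamPowFour_le ha b (by positivity) ((show _ ≤ r from hμ).trans ?_)
  nlinarith [le_abs_self r, abs_nonneg r]

theorem exists_forall_norm_lamPowFour_ne_radius {a : ℝ} (ha : a ≠ 0) (b : ℝ) (ξ : Ioo (0 : ℝ) 1)
    (T : ℝ) : ∃ N : ℕ, ∀ n ≥ N, ∀ α ∈ Icc (-T) T, ∀ μ : ℂ, IsEigenvalue (A a b α ξ) μ →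
      ‖lamPowFour a b μ‖ ≠ radius n ^ 4 := by
  obtain ⟨N, hN⟩ := exists_nat_gt (64 * (T / |a| * (|a| + |b| + 1)))
  refine ⟨N, fun n hn α hα μ heig hnorm => ?_⟩
  rw [isEigenvalue_iff ha, loadCoeff, ← mul_assoc] at heig
  refine freeChar_add_mul_loadChar_ne_zero ⟨ξ.2.1.le, ξ.2.2.le⟩ hnorm ?_ heig
  have hαT : |α| ≤ T := abs_le.2 hα
  have hT : 0 ≤ T := (abs_nonneg α).trans hαT
  have hn' : (N : ℝ) ≤ n := by exact_mod_cast hn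
  have hradius := natCast_add_one_le_radius n
  have hradius1 : 1 ≤ radius n := by linarith [n.cast_nonneg (α := ℝ)]
  have hμ : ‖μ‖ ≤ (|a| + |b| + 1) * radius n ^ 2 := by
    have hbound : ‖μ‖ ≤ |b| + (|a| + 1) * radius n ^ 2 :=
      norm_le_of_norm_lamPowFour_le ha b (sq_nonneg _) (hnorm.le.trans_eq (by ring))
    nlinarith [one_le_pow₀ (n := 2) hradius1, abs_nonneg b]
  calc 64 * ‖(α : ℂ) * (μ / a)‖ = 64 * (|α| / |a| * ‖μ‖) := by
        rw [norm_mul, norm_div, Complex.norm_real, Complex.norm_real, Real.norm_eq_abs,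
          Real.norm_eq_abs]
        ring
    _ ≤ 64 * (T / |a| * ((|a| + |b| + 1) * radius n ^ 2)) := by gcongr
    _ = 64 * (T / |a| * (|a| + |b| + 1)) * radius n ^ 2 := by ring
    _ < radius n * radius n ^ 2 := by gcongr; linarith
    _ = radius n ^ 3 := by ring

theorem exists_separating_radii {a : ℝ} (ha : a ≠ 0) (b : ℝ) (ξ : Ioo (0 : ℝ) 1) (T : ℝ) :
    ∃ ρ : ℕ → ℝ, ρ 0 < 0 ∧ Tendsto ρ atTop atTop ∧ ∀ k, ∀ α ∈ Icc (-T) T, ∀ μ : ℂ,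
      IsEigenvalue (A a b α ξ) μ → ‖lamPowFour a b μ‖ ≠ ρ k := by
  obtain ⟨N, hN⟩ := exists_forall_norm_lamPowFour_ne_radius ha b ξ T
  refine ⟨fun k => Nat.casesOn k (-1) fun k => radius (N + k) ^ 4, neg_one_lt_zero, ?_, ?_⟩
  · refine (tendsto_add_atTop_iff_nat 1).1 (tendsto_atTop_mono (fun k => ?_)
      tendsto_natCast_atTop_atTop)
    have hradius := natCast_add_one_le_radius (N + k)
    push_cast at hradius
    have hpow : radius (N + k) ≤ radius (N + k) ^ 4 :=
      le_self_pow₀ (by linarith [N.cast_nonneg (α := ℝ), k.cast_nonneg (α := ℝ)]) four_ne_zero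
    exact le_trans (by linarith [N.cast_nonneg (α := ℝ)]) hpow
  · rintro (_ | k) α hα μ heig
    · exact (neg_one_lt_zero.trans_le (norm_nonneg _)).ne'
    · exact hN _ (Nat.le_add_right N k) α hα μ heig

theorem exists_mem_Ioo_succ {L : Type*} [LinearOrder L] [NoMaxOrder L] {ρ : ℕ → L}
    (hρ : Tendsto ρ atTop atTop) {x : L} (h0 : ρ 0 < x) (hne : ∀ k, x ≠ ρ k) :
    ∃ k, x ∈ Ioo (ρ k) (ρ (k + 1)) := by
  classical
  have hex : ∃ k, x < ρ k := (hρ.eventually_gt_atTop x).exists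
  obtain ⟨k, hk⟩ := Nat.exists_eq_succ_of_ne_zero
    (fun hzero => h0.not_gt (hzero ▸ Nat.find_spec hex) : Nat.find hex ≠ 0)
  have hmin := Nat.find_min hex (hk ▸ Nat.lt_succ_self k)
  have hspec := Nat.find_spec hex
  rw [hk] at hspec
  exact ⟨k, (not_lt.1 hmin).lt_of_ne (hne k).symm, hspec⟩

theorem hasFiniteBranches_isEigenvalue {a : ℝ} (ha : a ≠ 0) (b : ℝ) (ξ : Ioo (0 : ℝ) 1)
    (hξ : Irrational (ξ : ℝ)) {s t c d : ℝ} (hst : s ≤ t)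
    (hcd : ∀ α ∈ Icc s t, ∀ μ, IsEigenvalue (A a b α ξ) μ →
      ‖lamPowFour a b μ‖ ≠ c ∧ ‖lamPowFour a b μ‖ ≠ d) :
    HasFiniteBranches (fun α : ℝ => {μ | ‖lamPowFour a b μ‖ ∈ Ioo c d} ∩
      {μ | IsEigenvalue (A a b α ξ) μ}) (Icc s t) := by
  have hcont : Continuous fun μ => ‖lamPowFour a b μ‖ :=
    (differentiable_lamPowFour a b).continuous.norm
  have hcompact : IsCompact {μ | ‖lamPowFour a b μ‖ ∈ Icc c d} :=
    (isCompact_setOf_norm_lamPowFour_le ha b d).of_isClosed_subset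
      (isClosed_Icc.preimage hcont) fun μ hμ => hμ.2
  refine (hasFiniteBranches_zeros_add_mul
    (differentiable_freeChar.comp (differentiable_lamPowFour a b)) (differentiable_loadCoeff a b ξ)
    (fun z hz => loadCoeff_ne_zero ha b hξ hz) (isOpen_Ioo.preimage hcont) hcompact
    (fun μ hμ => Ioo_subset_Icc_self hμ) hst (fun α _ => ⟨0, ?_⟩)
    fun α hα μ hμ hzero => ?_).congr fun α _ => ?_
  · rw [Function.comp_apply, lamPowFour_zero, freeChar_zero, loadCoeff, zero_div, zero_mul,
      mul_zero, add_zero]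
    exact one_ne_zero
  · obtain ⟨hc, hd⟩ := hcd α hα μ ((isEigenvalue_iff ha b α ξ μ).2 hzero)
    exact ⟨hμ.1.lt_of_ne hc.symm, hμ.2.lt_of_ne hd⟩
  · ext μ
    exact and_congr_right fun _ => (isEigenvalue_iff ha b α ξ μ).symm

theorem exists_seq_of_hasFiniteBranches {X E : Type*} [TopologicalSpace X] [TopologicalSpace E]
    {Z : X → Set E} {S : Set X} {Ω : ℕ → Set E}
    (hbranch : ∀ k, HasFiniteBranches (fun x => Ω k ∩ Z x) S)
    (hcover : ∀ x ∈ S, Z x ⊆ ⋃ k, Ω k) {x₀ : X} (hx₀ : x₀ ∈ S) (hinf : (Z x₀).Infinite) :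
    ∃ m : ℕ → X → E, (∀ j, ContinuousOn (m j) S) ∧ (∀ x ∈ S, range (fun j => m j x) = Z x) ∧
      ∀ B, {k | (Ω k ∩ B).Nonempty}.Finite → {j | ∃ x ∈ S, m j x ∈ B}.Finite := by
  choose G hfin hcont hG using hbranch
  have hfinG : ∀ k, Finite (G k) := fun k => hfin k
  have hrange : ∀ x ∈ S, range (fun γ : Σ k, G k => γ.2.1 x) = Z x := fun x hx => by
    refine Subset.antisymm ?_ fun z hz => ?_
    · rintro _ ⟨⟨k, γ, hγ⟩, rfl⟩
      exact ((hG k x hx).subset (mem_image_of_mem _ hγ)).2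
    · obtain ⟨k, hk⟩ := mem_iUnion.1 (hcover x hx hz)
      obtain ⟨γ, hγ, hγz⟩ := (hG k x hx).superset ⟨hk, hz⟩
      exact ⟨⟨k, γ, hγ⟩, hγz⟩
  have hinfG : Infinite (Σ k, G k) := by
    by_contra hnot
    have := not_infinite_iff_finite.1 hnot
    exact hinf (hrange x₀ hx₀ ▸ finite_range _)
  obtain ⟨hden⟩ := nonempty_denumerable (Σ k, G k)
  let e : ℕ ≃ Σ k, G k := (Denumerable.eqv _).symm
  refine ⟨fun j => (e j).2.1, fun j => hcont _ _ (e j).2.2, fun x hx => ?_, fun B hB => ?_⟩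
  · rw [← hrange x hx]
    exact e.surjective.range_comp fun γ : Σ k, G k => γ.2.1 x
  · refine ((hB.biUnion fun k _ => finite_range fun γ : G k => e.symm ⟨k, γ⟩)).subset ?_
    rintro j ⟨x, hx, hj⟩
    have hΩ := ((hG _ x hx).subset (mem_image_of_mem _ (e j).2.2)).1
    exact mem_iUnion₂.2 ⟨(e j).1, ⟨_, hΩ, hj⟩, (e j).2, e.symm_apply_apply j⟩

theorem exists_eigenvalue_branches {a : ℝ} (ha : a ≠ 0) (b : ℝ) (ξ : Ioo (0 : ℝ) 1)
    (hξ : Irrational (ξ : ℝ)) {T : ℝ} (hT : 0 ≤ T) :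
    ∃ m : ℕ → ℝ → ℂ, (∀ j, ContinuousOn (m j) (Icc (-T) T)) ∧
      (∀ α ∈ Icc (-T) T, ∀ μ : ℂ, IsEigenvalue (A a b α ξ) μ ↔ ∃ j, m j α = μ) ∧
      ∀ R : ℝ, {j : ℕ | ∃ α ∈ Icc (-T) T, ‖m j α‖ ≤ R}.Finite := by
  obtain ⟨ρ, hρ0, hρ, hsep⟩ := exists_separating_radii ha b ξ T
  obtain ⟨m, hcont, hrange, hfin⟩ := exists_seq_of_hasFiniteBranches
    (Ω := fun k => {μ | ‖lamPowFour a b μ‖ ∈ Ioo (ρ k) (ρ (k + 1))})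
    (fun k => hasFiniteBranches_isEigenvalue ha b ξ hξ (neg_le_self hT)
      fun α hα μ heig => ⟨hsep k α hα μ heig, hsep (k + 1) α hα μ heig⟩)
    (fun α hα μ heig => mem_iUnion.2 (exists_mem_Ioo_succ hρ
      (hρ0.trans_le (norm_nonneg (lamPowFour a b μ))) fun k => hsep k α hα μ heig))
    (show (0 : ℝ) ∈ Icc (-T) T from ⟨neg_nonpos.2 hT, hT⟩) (infinite_setOf_isEigenvalue_zero ha b ξ)
  refine ⟨m, hcont, fun α hα μ => (Set.ext_iff.1 (hrange α hα) μ).symm, fun R => ?_⟩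
  refine hfin {μ | ‖μ‖ ≤ R} ?_
  obtain ⟨M, hM⟩ := (hρ.eventually_ge_atTop ((|b| * R + R ^ 2) / |a|)).exists_forall_of_atTop
  refine (finite_Iio M).subset fun k hk => ?_
  obtain ⟨μ, hμk, hμR⟩ := hk
  by_contra hkM
  exact (hμk.1.trans_le (norm_lamPowFour_le a b hμR)).not_ge (hM k (not_lt.1 hkM))

theorem lt_of_forall_ne_of_isPreconnected {X L : Type*} [TopologicalSpace X] [LinearOrder L]
    [TopologicalSpace L] [OrderClosedTopology L] {S : Set X} (hS : IsPreconnected S) {u : X → L}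
    (hu : ContinuousOn u S) {c : L} (hne : ∀ x ∈ S, u x ≠ c) {x₀ : X} (hx₀ : x₀ ∈ S)
    (h0 : u x₀ < c) : ∀ x ∈ S, u x < c := by
  intro x hx
  by_contra! hcx
  obtain ⟨y, hy, hyc⟩ := hS.intermediate_value hx₀ hx hu ⟨h0.le, hcx⟩
  exact hne y hy hyc

theorem eventually_lt_of_frequently_lt {L : Type*} [LinearOrder L] [TopologicalSpace L]
    [OrderClosedTopology L] {u : ℝ → L} {t d : ℝ} (htd : t < d) (hu : ContinuousOn u (Ioo t d))
    {c : L} (hfreq : ∃ᶠ x in 𝓝[>] t, u x < c) (hne : ∀ᶠ x in 𝓝[>] t, u x ≠ c) :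
    ∀ᶠ x in 𝓝[>] t, u x < c := by
  obtain ⟨δ, hδ, hgood⟩ := mem_nhdsGT_iff_exists_Ioo_subset.1
    (inter_mem (Ioo_mem_nhdsGT htd) hne)
  have hIoo : Ioo t δ ∈ 𝓝[>] t := Ioo_mem_nhdsGT hδ
  obtain ⟨x₀, hx₀c, hx₀⟩ := (hfreq.and_eventually hIoo).exists
  exact mem_of_superset hIoo (lt_of_forall_ne_of_isPreconnected isPreconnected_Ioo
    (hu.mono fun x hx => (hgood hx).1) (fun x hx => (hgood hx).2) hx₀ hx₀c)

theorem eventually_eventually_dist_ne {X Y ι : Type*} [MetricSpace X] [ProperSpace X]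
    [TopologicalSpace Y] [T2Space Y] {f : X → Y} (hf : Continuous f) {z : X} {y : Y}
    (hiso : ∀ᶠ x in 𝓝[≠] z, f x ≠ y) {l : Filter ι} {μ : ι → X}
    (hlim : Tendsto (fun i => f (μ i)) l (𝓝 y)) :
    ∀ᶠ r in 𝓝[>] (0 : ℝ), ∀ᶠ i in l, dist (μ i) z ≠ r := by
  obtain ⟨η, hη, hball⟩ := Metric.mem_nhdsWithin_iff.1 hiso
  filter_upwards [Ioo_mem_nhdsGT hη] with r hr
  have hy : y ∉ f '' Metric.sphere z r := by
    rintro ⟨x, hx, rfl⟩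
    exact hball ⟨hx.trans_lt hr.2, Metric.ne_of_mem_sphere hx hr.1.ne'⟩ rfl
  have hopen : IsOpen (f '' Metric.sphere z r)ᶜ :=
    ((isCompact_sphere z r).image hf).isClosed.isOpen_compl
  filter_upwards [hlim (hopen.mem_nhds hy)] with i hi hdist
  exact hi (mem_image_of_mem f hdist)

theorem exists_tendsto_of_forall_isolated {X Y : Type*} [MetricSpace X] [ProperSpace X]
    [TopologicalSpace Y] [T2Space Y] {f : X → Y} (hf : Continuous f) {y : Y}
    (hiso : ∀ z, f z = y → ∀ᶠ x in 𝓝[≠] z, f x ≠ y) {μ : ℝ → X} {t d : ℝ} (htd : t < d)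
    (hμ : ContinuousOn μ (Ioo t d)) {K : Set X} (hK : IsCompact K) (hμK : ∀ x ∈ Ioo t d, μ x ∈ K)
    (hlim : Tendsto (fun x => f (μ x)) (𝓝[>] t) (𝓝 y)) :
    ∃ z, f z = y ∧ Tendsto μ (𝓝[>] t) (𝓝 z) := by
  obtain ⟨z, -, hz⟩ := hK.exists_mapClusterPt
    (tendsto_principal.2 (mem_of_superset (Ioo_mem_nhdsGT htd) hμK))
  have hfz : f z = y :=
    eq_of_nhds_neBot ((hz.continuousAt_comp hf.continuousAt).clusterPt.mono hlim)
  refine ⟨z, hfz, Metric.tendsto_nhds.2 fun ε hε => ?_⟩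
  obtain ⟨r, hne, hr⟩ := ((eventually_eventually_dist_ne hf (hiso z hfz) hlim).and
    (Ioo_mem_nhdsGT hε)).exists
  have hfreq : ∃ᶠ x in 𝓝[>] t, dist (μ x) z < r :=
    mapClusterPt_iff_frequently.1 hz _ (Metric.ball_mem_nhds z hr.1)
  filter_upwards [eventually_lt_of_frequently_lt htd
    ((continuous_id.dist continuous_const).comp_continuousOn hμ) hfreq hne] with x hx
  exact hx.trans hr.2

theorem exists_forall_norm_lamPowFour_lt {a : ℝ} (ha : a ≠ 0) (b : ℝ) (ξ : Ioo (0 : ℝ) 1)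
    {S : Set ℝ} (hS : IsPreconnected S) {T : ℝ} (hST : S ⊆ Icc (-T) T) {μ : ℝ → ℂ}
    (hμ : ContinuousOn μ S) (heig : ∀ α ∈ S, IsEigenvalue (A a b α ξ) (μ α)) :
    ∃ R, ∀ α ∈ S, ‖lamPowFour a b (μ α)‖ < R := by
  rcases S.eq_empty_or_nonempty with rfl | ⟨α₀, hα₀⟩
  · exact ⟨0, fun α hα => hα.elim⟩
  obtain ⟨ρ, -, hρ, hsep⟩ := exists_separating_radii ha b ξ T
  obtain ⟨k, hk⟩ := (hρ.eventually_gt_atTop ‖lamPowFour a b (μ α₀)‖).exists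
  exact ⟨ρ k, lt_of_forall_ne_of_isPreconnected hS
    ((differentiable_lamPowFour a b).continuous.norm.comp_continuousOn hμ)
    (fun α hα => hsep k α (hST hα) _ (heig α hα)) hα₀ hk⟩

theorem tendsto_freeChar_lamPowFour {a : ℝ} (ha : a ≠ 0) (b : ℝ) (ξ : Ioo (0 : ℝ) 1)
    {l : Filter ℝ} (hl : l ≤ 𝓝 0) {μ : ℝ → ℂ}
    (heig : ∀ᶠ α in l, IsEigenvalue (A a b α ξ) (μ α)) {R : ℝ}
    (hR : ∀ᶠ α in l, ‖lamPowFour a b (μ α)‖ ≤ R) :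
    Tendsto (fun α => freeChar (lamPowFour a b (μ α))) l (𝓝 0) := by
  obtain ⟨C, hC⟩ := (isCompact_setOf_norm_lamPowFour_le ha b R).exists_bound_of_continuousOn
    (differentiable_loadCoeff a b ξ).continuous.continuousOn
  have hload : Tendsto (fun α : ℝ => |α| * C) l (𝓝 0) := by
    have hcont : Continuous fun α : ℝ => |α| * C := continuous_abs.mul continuous_const
    exact (hcont.tendsto' 0 0 (by rw [abs_zero, zero_mul])).mono_left hl
  refine squeeze_zero_norm' ?_ hload
  filter_upwards [heig, hR] with α hα hαR
  rw [eq_neg_of_add_eq_zero_left ((isEigenvalue_iff ha b α ξ _).1 hα), norm_neg, norm_mul,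
    Complex.norm_real, Real.norm_eq_abs]
  exact mul_le_mul_of_nonneg_left (hC _ hαR) (abs_nonneg α)

theorem eventually_freeChar_lamPowFour_ne_zero (a b : ℝ) (z : ℂ) :
    ∀ᶠ μ in 𝓝[≠] z, freeChar (lamPowFour a b μ) ≠ 0 := by
  by_contra hfreq
  have hzero := AnalyticOnNhd.eqOn_zero_of_preconnected_of_frequently_eq_zero
    (fun μ _ => (differentiable_freeChar.comp (differentiable_lamPowFour a b)).analyticAt μ)
    isPreconnected_univ (mem_univ z) hfreq (mem_univ 0)
  rw [Function.comp_apply, lamPowFour_zero, freeChar_zero] at hzero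
  exact one_ne_zero hzero

theorem exists_tendsto_muZero {a : ℝ} (ha : a ≠ 0) (b : ℝ) (ξ : Ioo (0 : ℝ) 1) {d : ℝ}
    (hd : 0 < d) {μ : ℝ → ℂ} (hμ : ContinuousOn μ (Ioo 0 d))
    (heig : ∀ α ∈ Ioo 0 d, IsEigenvalue (A a b α ξ) (μ α)) :
    ∃ n : ℕ, 1 ≤ n ∧ ∃ s : ℤˣ, Tendsto μ (𝓝[>] 0) (𝓝 (muZero a b n s)) := by
  have hIoo : Ioo 0 d ∈ 𝓝[>] (0 : ℝ) := Ioo_mem_nhdsGT hd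
  obtain ⟨R, hR⟩ := exists_forall_norm_lamPowFour_lt ha b ξ isPreconnected_Ioo
    (fun α hα => ⟨by linarith [hα.1], hα.2.le⟩) hμ heig
  have hlim : Tendsto (fun α => freeChar (lamPowFour a b (μ α))) (𝓝[>] 0) (𝓝 0) :=
    tendsto_freeChar_lamPowFour ha b ξ nhdsWithin_le_nhds (mem_of_superset hIoo heig)
      (mem_of_superset hIoo fun α hα => (hR α hα).le)
  obtain ⟨z, hz, hμz⟩ := exists_tendsto_of_forall_isolated
    (differentiable_freeChar.comp (differentiable_lamPowFour a b)).continuous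
    (fun z _ => eventually_freeChar_lamPowFour_ne_zero a b z) hd hμ
    (isCompact_setOf_norm_lamPowFour_le ha b R) (fun α hα => (hR α hα).le) hlim
  have hzero : IsEigenvalue (A a b 0 ξ) z := by
    rw [isEigenvalue_iff ha, Complex.ofReal_zero, zero_mul, add_zero]
    exact hz
  obtain ⟨n, hn, s, rfl⟩ := (isEigenvalue_zero_iff ha b ξ z).1 hzero
  exact ⟨n, hn, s, hμz⟩

/-- The normalising factor of `phi ξ l`. -/
def phiScale (ξ : ℝ) (l : ℂ) : ℂ := ((1 / ‖l‖ ^ 2 * Real.exp ((ξ - 2) * ‖l‖) : ℝ) : ℂ)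

/-- The coefficient of `sin (l x)` in `phi ξ l x`, up to the factor `phiScale ξ l`. -/
def sinCoeff (ξ : ℝ) (l : ℂ) : ℂ := Complex.sinh l * Complex.sin (l * (1 - ξ))

/-- The coefficient of `sinh (l x)` in `phi ξ l x`, up to the factor `phiScale ξ l`. -/
def sinhCoeff (ξ : ℝ) (l : ℂ) : ℂ := -(Complex.sin l * Complex.sinh (l * (1 - ξ)))

theorem phiScale_ne_zero (ξ : ℝ) {l : ℂ} (hl : l ≠ 0) : phiScale ξ l ≠ 0 :=
  Complex.ofReal_ne_zero.2 (mul_ne_zero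
    (one_div_ne_zero (pow_ne_zero 2 (norm_ne_zero_iff.2 hl))) (Real.exp_ne_zero _))

theorem phi_I_mul (ξ : ℝ) (l : ℂ) (x : ℝ) :
    phi ξ (Complex.I * l) x = Complex.I * phi ξ l x := by
  have hsin : ∀ z : ℂ, Complex.sin (Complex.I * z) = Complex.I * Complex.sinh z := fun z => by
    rw [mul_comm, Complex.sin_mul_I, mul_comm]
  have hsinh : ∀ z : ℂ, Complex.sinh (Complex.I * z) = Complex.I * Complex.sin z := fun z => by
    rw [mul_comm, Complex.sinh_mul_I, mul_comm]
  have hnorm : ‖Complex.I * l‖ = ‖l‖ := by rw [norm_mul, Complex.norm_I, one_mul]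
  unfold phi
  rw [hnorm]
  simp only [mul_assoc Complex.I l, hsin, hsinh]
  ring_nf
  simp only [Complex.I_pow_three]
  ring

theorem phi_mul {ζ : ℂ} (hζ : ζ ^ 4 = 1) (ξ : ℝ) (l : ℂ) (x : ℝ) :
    phi ξ (ζ * l) x = ζ * phi ξ l x := by
  have hneg : ∀ l, phi ξ (-l) x = -phi ξ l x := fun l => by
    rw [← neg_one_mul l, ← Complex.I_mul_I, mul_assoc, phi_I_mul, phi_I_mul, ← mul_assoc,
      Complex.I_mul_I, neg_one_mul]
  have hfactor : (ζ ^ 2 - 1) * (ζ ^ 2 - Complex.I ^ 2) = 0 := by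
    rw [Complex.I_sq]
    linear_combination hζ
  rcases mul_eq_zero.1 hfactor with h | h
  · rcases sq_eq_one_iff.1 (sub_eq_zero.1 h) with rfl | rfl
    · rw [one_mul, one_mul]
    · rw [neg_one_mul, hneg, neg_one_mul]
  · rcases sq_eq_sq_iff_eq_or_eq_neg.1 (sub_eq_zero.1 h) with rfl | rfl
    · exact phi_I_mul ξ l x
    · rw [neg_mul, hneg, phi_I_mul, neg_mul]

theorem Phi_mul {ζ : ℂ} (hζ : ζ ^ 4 = 1) (ξ : ℝ) (l μ : ℂ) : Phi ξ (ζ * l) μ = ζ • Phi ξ l μ := by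
  ext x
  · exact phi_mul hζ ξ l x
  · change μ * phi ξ (ζ * l) x = ζ * (μ * phi ξ l x)
    rw [phi_mul hζ, mul_left_comm]

theorem profile_pow_four (ξ : ℝ) (l P Q S : ℂ) (x : ℝ) :
    profile ξ (l ^ 4) (l * (P + Q)) (l ^ 3 * (Q - P)) (2 * l ^ 3 * S) 0 x =
      P * Complex.sin (l * x) + Q * Complex.sinh (l * x) +
        S * (Complex.sinh (l * (x - ξ)) - Complex.sin (l * (x - ξ))) * if ξ ≤ x then 1 else 0 := by
  simp only [profile, hingedJet, Complex.ofReal_sub, sinh_mul_eq_krylov, sin_mul_eq_krylov]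
  split_ifs <;> ring

theorem phi_eq_phiScale_mul_profile (ξ : ℝ) (l : ℂ) (x : ℝ) :
    phi ξ l x = phiScale ξ l * profile ξ (l ^ 4) (l * (sinCoeff ξ l + sinhCoeff ξ l))
      (l ^ 3 * (sinhCoeff ξ l - sinCoeff ξ l)) (2 * l ^ 3 * (Complex.sin l * Complex.sinh l))
      0 x := by
  rw [profile_pow_four, phi, phiScale, sinCoeff, sinhCoeff]
  ring

theorem loadEq_sinCoeff_sinhCoeff {κ : ℂ} {ξ : ℝ} {l : ℂ}
    (h : freeChar (l ^ 4) + κ * loadChar ξ (l ^ 4) = 0) :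
    LoadEq κ ξ (l ^ 4) (l * (sinCoeff ξ l + sinhCoeff ξ l))
      (l ^ 3 * (sinhCoeff ξ l - sinCoeff ξ l)) (2 * l ^ 3 * (Complex.sin l * Complex.sinh l)) := by
  have hsinh := sinh_mul_eq_krylov l 1
  have hsin := sin_mul_eq_krylov l 1
  rw [mul_one] at hsinh hsin
  rw [sinCoeff, sinhCoeff, sinh_mul_eq_krylov, sin_mul_eq_krylov, hsin, hsinh]
  simp only [LoadEq, hingedJet]
  rw [freeChar, loadChar] at h
  push_cast
  refine ⟨by ring, by ring, ?_⟩
  linear_combination 2 * l ^ 5 * h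

theorem isEigenfunction_Phi {a : ℝ} (ha : a ≠ 0) {b α : ℝ} (ξ : Ioo (0 : ℝ) 1) {μ l : ℂ}
    (hl : l ≠ 0) (hpow : l ^ 4 = lamPowFour a b μ)
    (hcoeff : sinCoeff ξ l ≠ 0 ∨ sinhCoeff ξ l ≠ 0) (heig : IsEigenvalue (A a b α ξ) μ) :
    IsEigenfunction (A a b α ξ) μ (Phi ξ l μ) := by
  have hchar : freeChar (l ^ 4) + ((α / a : ℝ) * μ) * loadChar ξ (l ^ 4) = 0 := by
    have hzero := (isEigenvalue_iff ha b α ξ μ).1 heig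
    rw [hpow, ← hzero, loadCoeff, Complex.ofReal_div]
    ring
  have hload := loadEq_sinCoeff_sinhCoeff hchar
  simp only [hpow] at hload
  have hne : l * (sinCoeff ξ l + sinhCoeff ξ l) ≠ 0 ∨
      l ^ 3 * (sinhCoeff ξ l - sinCoeff ξ l) ≠ 0 := by
    contrapose! hcoeff
    have hadd := (mul_eq_zero.1 hcoeff.1).resolve_left hl
    have hsub := (mul_eq_zero.1 hcoeff.2).resolve_left (pow_ne_zero 3 hl)
    exact ⟨by linear_combination (hadd - hsub) / 2, by linear_combination (hadd + hsub) / 2⟩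
  convert! (isEigenfunction_profile ha ξ hne hload).const_smul (phiScale_ne_zero ξ hl) using 1
  funext x
  simp only [Phi, phi_eq_phiScale_mul_profile, hpow, Pi.smul_apply, Prod.smul_mk, smul_eq_mul,
    mul_left_comm μ]

theorem isEigenfunction_PhiZero {a : ℝ} (ha : a ≠ 0) (b : ℝ) (ξ : Ioo (0 : ℝ) 1) {n : ℕ}
    (hn : 1 ≤ n) (s : ℤˣ) :
    IsEigenfunction (A a b 0 ξ) (muZero a b n s) (PhiZero a b n s) := by
  have hprofile := profile_pow_four ξ (n * Real.pi) 1 0 0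
  have hload : LoadEq ((0 / a : ℝ) * muZero a b n s) ξ ((n * Real.pi : ℂ) ^ 4)
      (n * Real.pi * (1 + 0)) ((n * Real.pi) ^ 3 * (0 - 1)) (2 * (n * Real.pi) ^ 3 * 0) := by
    have hsin := sin_mul_eq_krylov (n * Real.pi) 1
    rw [mul_one, Complex.sin_nat_mul_pi] at hsin
    simp only [LoadEq, hingedJet]
    push_cast
    exact ⟨by linear_combination -hsin, by linear_combination (n * Real.pi : ℂ) ^ 2 * hsin,
      by ring⟩
  rw [← lamPowFour_muZero ha b n s] at hload hprofile
  convert! isEigenfunction_profile ha ξ (Or.inl ?_) hload using 1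
  · funext x
    rw [hprofile, PhiZero]
    ring_nf
  · rw [add_zero, mul_one]
    exact natCast_mul_pi_ne_zero hn

theorem arg_ne_neg_pi_div_four_of_pow_four_mem_slitPlane {z : ℂ}
    (hz : z ^ 4 ∈ Complex.slitPlane) : z.arg ≠ -(Real.pi / 4) := by
  intro harg
  have hpow : z ^ 4 = ((-‖z‖ ^ 4 : ℝ) : ℂ) := by
    conv_lhs => rw [← Complex.norm_mul_exp_arg_mul_I z]
    rw [mul_pow, ← Complex.exp_nat_mul, harg,
      show ((4 : ℕ) : ℂ) * (((-(Real.pi / 4) : ℝ) : ℂ) * Complex.I) = -(Real.pi * Complex.I) by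
        push_cast; ring,
      Complex.exp_neg, Complex.exp_pi_mul_I]
    push_cast
    ring
  rw [hpow, Complex.ofReal_mem_slitPlane] at hz
  linarith [pow_nonneg (norm_nonneg z) 4]

theorem pow_four_cpow_inv_four {z : ℂ} (harg : z.arg ∈ Ico (-(Real.pi / 4)) (Real.pi / 4))
    (hz : z ^ 4 ∈ Complex.slitPlane) : (z ^ 4) ^ (((4 : ℕ) : ℂ)⁻¹) = z := by
  refine Complex.pow_cpow_nat_inv four_ne_zero ?_ ?_
  · push_cast
    exact harg.1.lt_of_ne (arg_ne_neg_pi_div_four_of_pow_four_mem_slitPlane hz).symm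
  · push_cast
    exact harg.2.le

theorem tendsto_of_tendsto_pow_four {ι : Type*} {l : Filter ι} {u : ι → ℂ} {z : ℂ}
    (hu : ∀ᶠ i in l, (u i).arg ∈ Ico (-(Real.pi / 4)) (Real.pi / 4))
    (hz : z.arg ∈ Ico (-(Real.pi / 4)) (Real.pi / 4)) (hslit : z ^ 4 ∈ Complex.slitPlane)
    (hlim : Tendsto (fun i => u i ^ 4) l (𝓝 (z ^ 4))) : Tendsto u l (𝓝 z) := by
  have hroot := hlim.cpow (tendsto_const_nhds (x := ((4 : ℕ) : ℂ)⁻¹)) hslit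
  rw [pow_four_cpow_inv_four hz hslit] at hroot
  refine hroot.congr' ?_
  filter_upwards [hu, hlim (Complex.isOpen_slitPlane.mem_nhds hslit)] with i harg hi
  exact pow_four_cpow_inv_four harg hi

theorem tendsto_natCast_mul_pi_of_isPrincipalRoot {a : ℝ} (ha : a ≠ 0) {b : ℝ} {n : ℕ}
    (hn : 1 ≤ n) {s : ℤˣ} {ι : Type*} {l : Filter ι} {μ lam : ι → ℂ}
    (hlam : ∀ᶠ i in l, IsPrincipalRoot a b (μ i) (lam i))
    (hμ : Tendsto μ l (𝓝 (muZero a b n s))) : Tendsto lam l (𝓝 (n * Real.pi)) := by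
  have hpos : (0 : ℝ) < n * Real.pi := mul_pos (by exact_mod_cast hn) Real.pi_pos
  have hlim := ((differentiable_lamPowFour a b).continuous.tendsto _).comp hμ
  rw [lamPowFour_muZero ha] at hlim
  have hcast : (n * Real.pi : ℂ) = ((n * Real.pi : ℝ) : ℂ) := by push_cast; rfl
  refine tendsto_of_tendsto_pow_four (hlam.mono fun i hi => hi.2) ?_ ?_
    (hlim.congr' (hlam.mono fun i hi => hi.1.symm))
  · rw [hcast, Complex.arg_ofReal_of_nonneg hpos.le]
    exact ⟨by linarith [Real.pi_pos], by linarith [Real.pi_pos]⟩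
  · rw [hcast, ← Complex.ofReal_pow]
    exact Complex.ofReal_mem_slitPlane.2 (pow_pos hpos 4)

theorem continuous_sinCoeff (ξ : ℝ) : Continuous (sinCoeff ξ) := by
  unfold sinCoeff
  fun_prop

theorem sinCoeff_natCast_mul_pi_ne_zero {ξ : ℝ} (hξ : Irrational ξ) {n : ℕ} (hn : 1 ≤ n) :
    sinCoeff ξ (n * Real.pi) ≠ 0 := by
  have hsin := sin_natCast_mul_pi_mul_ne_zero (irrational_one_sub hξ) hn
  push_cast at hsin
  exact mul_ne_zero (sinh_natCast_mul_pi_ne_zero hn) hsin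

theorem continuousAt_phi (ξ x : ℝ) {l : ℂ} (hl : l ≠ 0) :
    ContinuousAt (fun l => phi ξ l x) l := by
  unfold phi
  refine (Complex.continuous_ofReal.continuousAt.comp ?_).mul (Continuous.continuousAt ?_)
  · have hnorm : ‖l‖ ^ 2 ≠ 0 := pow_ne_zero 2 (norm_ne_zero_iff.2 hl)
    fun_prop (disch := exact hnorm)
  · fun_prop

theorem tendsto_Phi {ι : Type*} {F : Filter ι} (ξ x : ℝ) {l μ : ι → ℂ} {l₀ μ₀ : ℂ}
    (hl₀ : l₀ ≠ 0) (hl : Tendsto l F (𝓝 l₀)) (hμ : Tendsto μ F (𝓝 μ₀)) :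
    Tendsto (fun i => Phi ξ (l i) (μ i) x) F (𝓝 (Phi ξ l₀ μ₀ x)) := by
  have hphi : Tendsto (fun i => phi ξ (l i) x) F (𝓝 (phi ξ l₀ x)) :=
    (continuousAt_phi ξ x hl₀).tendsto.comp hl
  exact hphi.prodMk_nhds (hμ.mul hphi)

theorem Phi_natCast_mul_pi (a b ξ : ℝ) (n : ℕ) (s : ℤˣ) (x : ℝ) :
    Phi ξ (n * Real.pi) (muZero a b n s) x =
      (phiScale ξ (n * Real.pi) * sinCoeff ξ (n * Real.pi)) • PhiZero a b n s x := by
  have hphi : phi ξ (n * Real.pi) x =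
      phiScale ξ (n * Real.pi) * sinCoeff ξ (n * Real.pi) * Complex.sin (n * Real.pi * x) := by
    rw [phi, Complex.sin_nat_mul_pi, phiScale, sinCoeff]
    ring
  rw [Phi, hphi, PhiZero, Prod.smul_mk, smul_eq_mul, smul_eq_mul, mul_left_comm]

theorem eventually_isEigenfunction_Phi {a : ℝ} (ha : a ≠ 0) {b : ℝ} (ξ : Ioo (0 : ℝ) 1)
    (hξ : Irrational (ξ : ℝ)) {n : ℕ} (hn : 1 ≤ n) {l : Filter ℝ} {μ lam : ℝ → ℂ}
    (heig : ∀ᶠ α in l, IsEigenvalue (A a b α ξ) (μ α))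
    (hlam : ∀ᶠ α in l, IsPrincipalRoot a b (μ α) (lam α))
    (hlim : Tendsto lam l (𝓝 (n * Real.pi))) :
    ∀ᶠ α in l, IsEigenfunction (A a b α ξ) (μ α) (Phi ξ (lam α) (μ α)) := by
  filter_upwards [heig, hlam, hlim.eventually_ne (natCast_mul_pi_ne_zero hn),
    (((continuous_sinCoeff ξ).tendsto _).comp hlim).eventually_ne
      (sinCoeff_natCast_mul_pi_ne_zero hξ hn)] with α hα hroot hne hcoeff
  exact isEigenfunction_Phi ha ξ hne hroot.1 (Or.inl hcoeff) hα

theorem exists_isEigenfunction_Phi_and_tendsto {a : ℝ} (ha : a ≠ 0) {b : ℝ} (ξ : Ioo (0 : ℝ) 1)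
    (hξ : Irrational (ξ : ℝ)) {n : ℕ} (hn : 1 ≤ n) {s : ℤˣ} {l : Filter ℝ} {μ lam : ℝ → ℂ}
    (heig : ∀ᶠ α in l, IsEigenvalue (A a b α ξ) (μ α))
    (hlam : ∀ᶠ α in l, IsPrincipalRoot a b (μ α) (lam α))
    (hμ : Tendsto μ l (𝓝 (muZero a b n s))) {ζ : ℂ} (hζ : ζ ^ 4 = 1) :
    (∀ᶠ α in l, IsEigenfunction (A a b α ξ) (μ α) (Phi ξ (ζ * lam α) (μ α))) ∧
      ∃ c : ℂ, c ≠ 0 ∧ ∀ x : ℝ, Tendsto (fun α => Phi ξ (ζ * lam α) (μ α) x) l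
        (𝓝 (c • PhiZero a b n s x)) := by
  have hlim := tendsto_natCast_mul_pi_of_isPrincipalRoot ha hn hlam hμ
  have hζ0 : ζ ≠ 0 := fun h => by simp [h] at hζ
  have hl0 := natCast_mul_pi_ne_zero hn
  simp only [Phi_mul hζ]
  refine ⟨(eventually_isEigenfunction_Phi ha ξ hξ hn heig hlam hlim).mono fun α hα =>
    hα.const_smul hζ0, ζ * (phiScale ξ (n * Real.pi) * sinCoeff ξ (n * Real.pi)),
    mul_ne_zero hζ0 (mul_ne_zero (phiScale_ne_zero ξ hl0)
      (sinCoeff_natCast_mul_pi_ne_zero hξ hn)), fun x => ?_⟩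
  rw [mul_smul, ← Phi_natCast_mul_pi]
  exact (tendsto_Phi ξ x hl0 hlim hμ).const_smul ζ

end Beam

end

theorem mainTheorem10_general {a : ℝ} (ha : a ≠ 0) (b : ℝ) (ξ : Ioo (0 : ℝ) 1)
    (hξ : Irrational (ξ : ℝ)) :
    (∀ S : Set ℝ, Bornology.IsBounded S → ∃ m : ℕ → ℝ → ℂ, (∀ j, ContinuousOn (m j) S) ∧
      (∀ α ∈ S, ∀ μ : ℂ, Beam.IsEigenvalue (Beam.A a b α ξ) μ ↔ ∃ j, m j α = μ) ∧
      ∀ R : ℝ, {j : ℕ | ∃ α ∈ S, ‖m j α‖ ≤ R}.Finite) ∧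
    ∀ d : ℝ, 0 < d → ∀ μ lam : ℝ → ℂ, ContinuousOn μ (Ioo 0 d) →
      (∀ α ∈ Ioo 0 d, Beam.IsEigenvalue (Beam.A a b α ξ) (μ α)) →
      (∀ α ∈ Ioo 0 d, Beam.IsPrincipalRoot a b (μ α) (lam α)) →
      ∃ n : ℕ, 1 ≤ n ∧ ∃ s : ℤˣ,
        Beam.IsEigenfunction (Beam.A a b 0 ξ) (Beam.muZero a b n s) (Beam.PhiZero a b n s) ∧
        Tendsto μ (𝓝[>] 0) (𝓝 (Beam.muZero a b n s)) ∧
        ∀ ζ : ℂ, ζ ^ 4 = 1 →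
          (∀ᶠ α in 𝓝[>] 0, Beam.IsEigenfunction (Beam.A a b α ξ) (μ α)
            (Beam.Phi ξ (ζ * lam α) (μ α))) ∧
          ∃ c : ℂ, c ≠ 0 ∧ ∀ x : ℝ, Tendsto (fun α => Beam.Phi ξ (ζ * lam α) (μ α) x) (𝓝[>] 0)
            (𝓝 (c • Beam.PhiZero a b n s x)) := by
  refine ⟨fun S hS => ?_, fun d hd μ lam hμ heig hlam => ?_⟩
  · obtain ⟨T, hT, hST⟩ := hS.subset_closedBall_lt 0 0
    rw [Real.closedBall_eq_Icc, zero_sub, zero_add] at hST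
    obtain ⟨m, hcont, hm, hfin⟩ := Beam.exists_eigenvalue_branches ha b ξ hξ hT.le
    exact ⟨m, fun j => (hcont j).mono hST, fun α hα => hm α (hST hα), fun R =>
      (hfin R).subset fun j ⟨α, hα, hR⟩ => ⟨α, hST hα, hR⟩⟩
  · obtain ⟨n, hn, s, hlim⟩ := Beam.exists_tendsto_muZero ha b ξ hd hμ heig
    have hIoo : Ioo 0 d ∈ 𝓝[>] (0 : ℝ) := Ioo_mem_nhdsGT hd
    exact ⟨n, hn, s, Beam.isEigenfunction_PhiZero ha b ξ hn s, hlim, fun ζ hζ =>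
      Beam.exists_isEigenfunction_Phi_and_tendsto ha ξ hξ hn (mem_of_superset hIoo heig)
        (mem_of_superset hIoo hlam) hlim hζ⟩

theorem mainTheorem10 (a b : ℝ) (ha : 0 < a) (hb : 0 < b) (ξ : Ioo (0 : ℝ) 1)
    (hξ : Irrational (ξ : ℝ)) :
    -- The eigenvalues are continuous functions of `α`.
    (∃ m : ℕ → ℝ → ℂ,
      (∀ j, ContinuousOn (m j) {α : ℝ | 0 ≤ α ∧ α * b < 6}) ∧
      (∀ α : ℝ, 0 ≤ α → α * b < 6 → ∀ μ : ℂ,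
        Beam.IsEigenvalue (Beam.A a b α ξ) μ ↔ ∃ j, m j α = μ) ∧
      (∀ R : ℝ, {j : ℕ | ∃ α : ℝ, 0 ≤ α ∧ α * b < 6 ∧ ‖m j α‖ ≤ R}.Finite)) ∧
    -- Along every continuous branch of eigenvalues the eigenvectors converge as `α → 0⁺`.
    (∀ (α₁ : ℝ), 0 < α₁ → α₁ * b ≤ 6 → ∀ μ lam : ℝ → ℂ,
      ContinuousOn μ (Ioo 0 α₁) →
      (∀ α ∈ Ioo 0 α₁, Beam.IsEigenvalue (Beam.A a b α ξ) (μ α)) →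
      (∀ α ∈ Ioo 0 α₁, Beam.IsPrincipalRoot a b (μ α) (lam α)) →
      ∃ n : ℕ, 1 ≤ n ∧ ∃ s : ℤˣ,
        Beam.IsEigenfunction (Beam.A a b 0 ξ) (Beam.muZero a b n s) (Beam.PhiZero a b n s) ∧
        Tendsto μ (𝓝[>] 0) (𝓝 (Beam.muZero a b n s)) ∧
        ∀ ζ : ℂ, ζ ^ 4 = 1 →
          (∀ᶠ α in 𝓝[>] 0, Beam.IsEigenfunction (Beam.A a b α ξ) (μ α)
            (Beam.Phi ξ (ζ * lam α) (μ α))) ∧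
          ∃ c : ℂ, c ≠ 0 ∧ ∀ x ∈ Ioo (0 : ℝ) 1,
            Tendsto (fun α => Beam.Phi ξ (ζ * lam α) (μ α) x) (𝓝[>] 0)
              (𝓝 (c • Beam.PhiZero a b n s x))) := by
  have hsub : {α : ℝ | 0 ≤ α ∧ α * b < 6} ⊆ Icc 0 (6 / b) := fun α hα =>
    ⟨hα.1, (le_div_iff₀ hb).2 hα.2.le⟩
  obtain ⟨hbranches, hlimits⟩ := mainTheorem10_general ha.ne' b ξ hξ
  refine ⟨?_, fun α₁ hα₁ _ μ lam hμ heig hlam => ?_⟩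
  · obtain ⟨m, hcont, hm, hfin⟩ := hbranches _ ((Metric.isBounded_Icc 0 (6 / b)).subset hsub)
    exact ⟨m, hcont, fun α h0 h6 => hm α ⟨h0, h6⟩, fun R =>
      (hfin R).subset fun j ⟨α, h0, h6, hR⟩ => ⟨α, ⟨h0, h6⟩, hR⟩⟩
  · obtain ⟨n, hn, s, hev, hlim, hfun⟩ := hlimits α₁ hα₁ μ lam hμ heig hlam
    refine ⟨n, hn, s, hev, hlim, fun ζ hζ => ?_⟩
    obtain ⟨heventually, c, hc, hconv⟩ := hfun ζ hζ
    exact ⟨heventually, c, hc, fun x _ => hconv x⟩
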